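/- **Game.** Fix a discount rate $\rho>0$, payoffs $0<\beta<\mu<\theta<1$, and $\sigma\in(0,1)$. The risky action pays $\omega\in\{0,1\}$ to both players, with $\Pr(\omega=1)=\mu$; the safe action pays $\theta$ to the principal and $\beta$ to the agent. Real news arrives at a random time, independent of $\omega$, with distribution function $G(t)=\int_0^t g(s)\,ds<1$ ($t\ge 0$), where $g\ge 0$ is continuous on $[0,\infty)$; $\lim_{t\to\infty}G(t)<1$ is allowed. The hazard rate $H_R=g/(1-G)$ is strictly decreasing on $[0,\infty)$. Put $\phi_P=\frac{\rho\theta}{\mu(1-\theta)}$, $\phi_A=\frac{\rho\mu}{\beta(1-\mu)}$ and assume $H_R(0)>\phi_P>\lim_{t\to\infty}H_R(t)$ and $\phi_P>\phi_A$. Let $\tau_P$ be the principal's optimal first-best search duration, i.e. the maximizer over $t\ge0$ of $$u_P^{FB}(t)=\int_0^t e^{-\rho s}g(s)\,(\mu+(1-\mu)\theta)\,ds+e^{-\rho t}(1-G(t))\theta .$$ **Strategies.** Real news is of type $\omega$. With probability $\sigma$ the agent can fake type-1 news, at a time drawn from a distribution $F_A$ on $[0,\infty]$; the principal stops and chooses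 safe, absent news, at a time drawn from a distribution $F_P$ on $[0,\infty]$. On $[0,\infty)$ each $F_i$ is the sum of an absolutely continuous part, with a given density $f_i^*\ge 0$, and countably many atoms; $f_i=f_i^*+$ a Dirac mass at each atom, and $f_i(t)>0$ means that $f_i^*(t)>0$ or that $t$ is an atom (at $t=\infty$: that $F_i$ puts positive mass on $\infty$). The principal chooses safe after type-0 news, and risky with probability $a(t)\in[0,1]$ ($a$ measurable) after type-1 news at time $t$. **Payoffs.** Integrals $\int_0^t$ below include atoms in $[0,t]$. The posterior after type-1 news at $s$ is $$\mu_1(s)=\frac{\mu g(s)(1-\sigma F_A(s))+\mu\sigma f_A(s)(1-G(s))}{\mu g(s)(1-\sigma F_A(s))+\sigma f_A(s)(1-G(s))},$$ read as $\mu$ at an atom of $F_A$. With $w_0^P=(1-\mu)g(1-\sigma F_A)$ and $w_1^P=\mu g(1-\sigma F_A)+\sigma f_A(1-G)$, $$u_P(t)=\int_0^t e^{-\rho s}\{w_0^P\theta+w_1^P((1-a)\theta+a\mu_1)\}\,ds+e^{-\rho t}(1-G(t))(1-\sigma F_A(t))\theta ,$$ $$u_A(t)=\int_0^t e^{-\rho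 s}\{[(1-\mu)\beta+\mu((1-a)\beta+a)]\,g(1-F_P)+\beta f_P(1-G)\}\,ds+e^{-\rho t}(1-G(t))(1-F_P(t))((1-a(t))\beta+\mu a(t)),$$ where $u_i(\infty)$ is given by the integral over $[0,\infty)$ alone. **Equilibrium.** $(a,F_P,F_A)$ is an equilibrium if: for each $i\in\{A,P\}$ and all $t,t'\in[0,\infty]$, $f_i(t)>0$ implies $u_i(t)\ge u_i(t')$; and for all $t\in[0,\infty)$, $a(t)=1$ if $\mu_1(t)>\theta$ and $a(t)=0$ if $\mu_1(t)<\theta$. It has *beneficial search* if the principal's payoff $\mathbb E_{t\sim F_P}[u_P(t)]$ exceeds $\theta$. **Proposition.** In any equilibrium with beneficial search there is $\tau_M$ with $0<\tau_M<\tau_P$ such that (i) the agent's faking time is finite almost surely, and its distribution has no atoms and has support exactly $[\tau_M,\tau_P]$; (ii) the principal's stopping time is finite almost surely, its distribution has support exactly $[\tau_M,\tau_P]$, and it has no atom except possibly at $\tau_P$; (iii) $a(t)=1$ for all $t\ge 0$. -/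

import Mathlib

open Set Filter Topology MeasureTheory

noncomputable section

namespace NewsSearch

/-- The primitives of the game: discount rate `ρ`, safe payoff `θ` of the principal, safe payoff
`β` of the agent, prior `μ = Pr(ω = 1)`, probability `σ` that the agent is able to fake, and
density `g` (on `[0, ∞)`) of the arrival time of real news. -/
structure Game where
  ρ : ℝ
  θ : ℝ
  β : ℝ
  μ : ℝ
  σ : ℝ
  g : ℝ → ℝ

namespace Game

variable (Γ : Game)

/-- Distribution function of the arrival time of real news. -/
def G (t : ℝ) : ℝ := ∫ s in (0 : ℝ)..t, Γ.g s

/-- Hazard rate `H_R` of real news. -/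
def hazard (t : ℝ) : ℝ := Γ.g t / (1 - Γ.G t)

def φP : ℝ := Γ.ρ * Γ.θ / (Γ.μ * (1 - Γ.θ))

def φA : ℝ := Γ.ρ * Γ.μ / (Γ.β * (1 - Γ.μ))

/-- Standing assumptions of the model. Real news may fail to arrive with positive probability:
`G` need not tend to `1`. -/
structure Standing : Prop where
  ρ_pos : 0 < Γ.ρ
  β_pos : 0 < Γ.β
  β_lt_μ : Γ.β < Γ.μ
  μ_lt_θ : Γ.μ < Γ.θ
  θ_lt_one : Γ.θ < 1
  σ_pos : 0 < Γ.σ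
  σ_lt_one : Γ.σ < 1
  g_nonneg : ∀ t, 0 ≤ t → 0 ≤ Γ.g t
  g_cont : ContinuousOn Γ.g (Ici 0)
  G_lt_one : ∀ t, 0 ≤ t → Γ.G t < 1
  hazard_anti : StrictAntiOn Γ.hazard (Ici 0)
  /-- A1: `H_R(0) > φ_P > H_R(∞)`. -/
  φP_lt_hazard_zero : Γ.φP < Γ.hazard 0
  hazard_infty_lt_φP : ∃ L, Tendsto Γ.hazard atTop (𝓝 L) ∧ L < Γ.φP
  /-- A2: `φ_P > φ_A`. -/
  φA_lt_φP : Γ.φA < Γ.φP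

/-- First-best payoff of the principal: she searches for duration `t`, all news is real and
followed, and she takes the safe action at `t` if no news has arrived. -/
def uFBP (t : ℝ) : ℝ :=
  (∫ s in (0 : ℝ)..t, Real.exp (-Γ.ρ * s) * Γ.g s * (Γ.μ + (1 - Γ.μ) * Γ.θ)) +
    Real.exp (-Γ.ρ * t) * (1 - Γ.G t) * Γ.θ

/-- `τ` is an optimal first-best search duration of the principal. -/
def IsFirstBestDuration (τ : ℝ) : Prop :=
  0 ≤ τ ∧ ∀ t, 0 ≤ t → Γ.uFBP t ≤ Γ.uFBP τ

end Game

/-- A mixed strategy over times in `[0, ∞]` with an absolutely continuous part, given by a density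
`density` (the `f*` of the strategy), and a discrete part: `atom t` is the probability of the
single time `t`, and `never` the probability of the time `∞`. -/
structure TimeStrategy where
  density : ℝ → ℝ
  atom : ℝ → ℝ
  never : ℝ
  density_nonneg : ∀ t, 0 ≤ density t
  density_neg : ∀ t, t < 0 → density t = 0
  density_integrable : Integrable density
  atom_nonneg : ∀ t, 0 ≤ atom t
  atom_neg : ∀ t, t < 0 → atom t = 0
  atom_summable : Summable atom
  never_nonneg : 0 ≤ never
  total : (∫ s, density s) + (∑' s, atom s) + never = 1

namespace TimeStrategy

variable (F : TimeStrategy)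

/-- The cumulative distribution function. -/
def cdf (t : ℝ) : ℝ :=
  (∫ s in Iic t, F.density s) + ∑' s, (if s ≤ t then F.atom s else 0)

/-- `f(t) > 0`, where `f` is the density plus a Dirac mass at each atom. -/
def Charges (t : ℝ) : Prop := 0 < F.density t ∨ 0 < F.atom t

/-- The finite times all of whose neighbourhoods have positive probability. -/
def support : Set ℝ := {t | ∀ ε > 0, F.cdf (t - ε) < F.cdf (t + ε)}

/-- The strategy is optimal for a payoff function with value `u t` at a finite time `t` and
`uNever` at time `∞`: every time that it charges maximizes the payoff. -/
structure Optimal (u : ℝ → ℝ) (uNever : ℝ) : Prop where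
  finite_finite : ∀ t, 0 ≤ t → F.Charges t → ∀ t', 0 ≤ t' → u t' ≤ u t
  finite_never : ∀ t, 0 ≤ t → F.Charges t → uNever ≤ u t
  never_finite : 0 < F.never → ∀ t', 0 ≤ t' → u t' ≤ uNever

/-- Expectation of the payoff under the strategy. -/
def expect (u : ℝ → ℝ) (uNever : ℝ) : ℝ :=
  (∫ s, F.density s * u s) + (∑' s, F.atom s * u s) + F.never * uNever

end TimeStrategy

/-- A strategy profile: response `a t` (probability of the risky action after type-1 news at `t`)
and stopping strategy `FP` of the principal, faking strategy `FA` of the agent. -/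
structure Profile where
  a : ℝ → ℝ
  FP : TimeStrategy
  FA : TimeStrategy
  a_measurable : Measurable a
  a_nonneg : ∀ t, 0 ≤ t → 0 ≤ a t
  a_le_one : ∀ t, 0 ≤ t → a t ≤ 1

namespace Profile

variable (Γ : Game) (S : Profile)

/-! ### The principal -/

/-- Density of type-0 news arrivals. -/
def w0P (s : ℝ) : ℝ := (1 - Γ.μ) * Γ.g s * (1 - Γ.σ * S.FA.cdf s)

/-- Density of type-1 news arrivals (absolutely continuous part). -/
def w1P (s : ℝ) : ℝ :=
  Γ.μ * Γ.g s * (1 - Γ.σ * S.FA.cdf s) + Γ.σ * S.FA.density s * (1 - Γ.G s)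

/-- Probability of a type-1 news arrival exactly at `s` (discrete part). -/
def w1PAtom (s : ℝ) : ℝ := Γ.σ * S.FA.atom s * (1 - Γ.G s)

/-- Probability of no news up to and including `t`. -/
def WP (t : ℝ) : ℝ := (1 - Γ.G t) * (1 - Γ.σ * S.FA.cdf t)

open Classical in
/-- Posterior probability of `ω = 1` after type-1 news at `s`. At an atom of the faking strategy
the news is almost surely fake, and the posterior is the prior. -/
def belief (s : ℝ) : ℝ :=
  if 0 < S.FA.atom s then Γ.μ
  else
    (Γ.μ * Γ.g s * (1 - Γ.σ * S.FA.cdf s) + Γ.μ * Γ.σ * S.FA.density s * (1 - Γ.G s)) /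
      (Γ.μ * Γ.g s * (1 - Γ.σ * S.FA.cdf s) + Γ.σ * S.FA.density s * (1 - Γ.G s))

/-- The principal's payoff when type-1 news arrives at `s`. -/
def news1P (s : ℝ) : ℝ := (1 - S.a s) * Γ.θ + S.a s * S.belief Γ s

/-- Discounted density of the principal's payoff from news at `s`. -/
def flowP (s : ℝ) : ℝ :=
  Real.exp (-Γ.ρ * s) * (S.w0P Γ s * Γ.θ + S.w1P Γ s * S.news1P Γ s)

/-- Discounted payoff of the principal from the mass of type-1 news exactly at `s`. -/
def jumpP (s : ℝ) : ℝ := Real.exp (-Γ.ρ * s) * (S.w1PAtom Γ s * S.news1P Γ s)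

/-- The principal's payoff of waiting for news until `t` and then choosing safe. -/
def uP (t : ℝ) : ℝ :=
  (∫ s in (0 : ℝ)..t, S.flowP Γ s) + (∑' s, (if s ≤ t then S.jumpP Γ s else 0)) +
    Real.exp (-Γ.ρ * t) * S.WP Γ t * Γ.θ

/-- The principal's payoff of waiting for news forever. -/
def uPNever : ℝ := (∫ s in Ioi (0 : ℝ), S.flowP Γ s) + ∑' s, S.jumpP Γ s

/-! ### The agent -/

/-- Density of real type-0 news arrivals before the principal stops. -/
def w0A (s : ℝ) : ℝ := (1 - Γ.μ) * Γ.g s * (1 - S.FP.cdf s)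

/-- Density of real type-1 news arrivals before the principal stops. -/
def w1A (s : ℝ) : ℝ := Γ.μ * Γ.g s * (1 - S.FP.cdf s)

/-- Density of the principal stopping before news (absolutely continuous part). -/
def wSA (s : ℝ) : ℝ := S.FP.density s * (1 - Γ.G s)

/-- Probability of the principal stopping exactly at `s` before news (discrete part). -/
def wSAAtom (s : ℝ) : ℝ := S.FP.atom s * (1 - Γ.G s)

/-- Probability that neither real news nor stopping occurs up to and including `t`. -/
def WA (t : ℝ) : ℝ := (1 - Γ.G t) * (1 - S.FP.cdf t)

/-- Discounted density of the agent's payoff from real news or stopping at `s`. -/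
def flowA (s : ℝ) : ℝ :=
  Real.exp (-Γ.ρ * s) * (S.w0A Γ s * Γ.β +
    S.w1A Γ s * ((1 - S.a s) * Γ.β + S.a s) + S.wSA Γ s * Γ.β)

/-- Discounted payoff of the agent from the mass of stopping exactly at `s`. -/
def jumpA (s : ℝ) : ℝ := Real.exp (-Γ.ρ * s) * (S.wSAAtom Γ s * Γ.β)

/-- The agent's payoff of faking at time `t`. -/
def uA (t : ℝ) : ℝ :=
  (∫ s in (0 : ℝ)..t, S.flowA Γ s) + (∑' s, (if s ≤ t then S.jumpA Γ s else 0)) +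
    Real.exp (-Γ.ρ * t) * S.WA Γ t * ((1 - S.a t) * Γ.β + Γ.μ * S.a t)

/-- The agent's payoff of never faking. -/
def uANever : ℝ := (∫ s in Ioi (0 : ℝ), S.flowA Γ s) + ∑' s, S.jumpA Γ s

/-! ### Equilibrium -/

structure IsEquilibrium : Prop where
  /-- The faking strategy is optimal. -/
  agent : S.FA.Optimal (S.uA Γ) (S.uANever Γ)
  /-- The response to type-1 news is optimal at every time, given the posterior. -/
  risky : ∀ t, 0 ≤ t → Γ.θ < S.belief Γ t → S.a t = 1
  safe : ∀ t, 0 ≤ t → S.belief Γ t < Γ.θ → S.a t = 0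
  /-- The stopping strategy is optimal. -/
  principal : S.FP.Optimal (S.uP Γ) (S.uPNever Γ)

/-- The principal's payoff in the profile. -/
def payoffP : ℝ := S.FP.expect (S.uP Γ) (S.uPNever Γ)

/-- Search is beneficial: the principal's payoff exceeds that of deciding on the prior alone. -/
def BeneficialSearch : Prop := Γ.θ < S.payoffP Γ

end Profile

end NewsSearch

end

/-!
The argument rests on two payoff formulas obtained from an integration by parts against mixed
strategies (`TimeStrategy.mul_cdf_eq`). As the principal responds optimally to news, her payoff
`uP` from stopping at `t` is `θ` plus the integral over `[0, t]` of a locally integrable function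
(`Profile.uP_eq`): the gain from following news, which vanishes where news is not surely followed,
net of the cost of delay. Atoms of the faking strategy drop out. The agent's payoff from faking at
`t` lies between `ignoredA t`, which is again a primitive, and
`followedA t = ignoredA t + e^{-ρt} (1 - G t) (1 - F_P t) (μ - β)`, according to how likely news at
`t` is followed (`Profile.uA_eq`).

By optimality the principal has a value `V`, which bounds `uP` and is attained wherever her
strategy charges, hence, by continuity, on its whole support. The agent's value `U` likewise bounds
`uA` and is attained wherever his strategy charges. Beneficial search means `θ < V`, so time `0`,
where `uP` is `θ`, is not in the support of the stopping strategy.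

* Past `τ_P` the payoff `uP` strictly decreases, so the principal has surely stopped by `τ_P`. Let
  `T` be the earliest such time. If news were not followed on an interval ending at `T`, then `uP`
  would decrease there, although it is maximal at `T`; so news is followed at times arbitrarily
  close to `T`, and faking then beats faking at or after `T`. Hence there is no faking from `T` on,
  which makes `uP` increase on `[T, τ_P]` and forces `T = τ_P`
  (`Profile.faking_ends_before`).
* Before `τ_P`, `followedA ≤ U` (`Profile.followedA_le`). Where this fails, news is not surely
  followed, so the principal does not stop. At the end of such an interval `followedA` would be
  increasing, since `H_R ≥ φ_P > φ_A`, and could not come down to `U`; so the interval would extend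
  to `τ_P`, and `uP` would not be maximal at `τ_P`. Consequently all news is followed
  (`Profile.a_eq_one`), which excludes atoms of fake news, where the posterior is only `μ < θ`.
* On an interval in which the principal does not stop, the agent prefers to wait and does not
  fake; on an interval without faking before `τ_P`, the principal prefers to wait. Therefore
  neither support has a gap between its infimum and `τ_P`, and the two supports coincide
  (`Profile.exists_common_support`). In the same way, an atom of the stopping strategy before `τ_P`
  would deter the agent right after it and make waiting optimal for the principal
  (`Profile.FP_atom`).
-/

open Set Filter Topology MeasureTheory

noncomputable section

/-! ### Mixed strategies over times -/

namespace NewsSearch.TimeStrategy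

variable (F : TimeStrategy)

lemma not_charges_iff {F : TimeStrategy} {t : ℝ} :
    ¬ F.Charges t ↔ F.density t = 0 ∧ F.atom t = 0 := by
  have h1 := F.density_nonneg t
  have h2 := F.atom_nonneg t
  simp only [Charges, not_or, not_lt]
  exact ⟨fun h => ⟨le_antisymm h.1 h1, le_antisymm h.2 h2⟩, fun h => ⟨h.1.le, h.2.le⟩⟩

lemma not_charges_of_neg {t : ℝ} (ht : t < 0) : ¬ F.Charges t :=
  not_charges_iff.2 ⟨F.density_neg t ht, F.atom_neg t ht⟩

lemma summable_atom_le (t : ℝ) : Summable fun s => if s ≤ t then F.atom s else 0 :=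
  F.atom_summable.of_nonneg_of_le (fun s => by split_ifs <;> simp [F.atom_nonneg])
    (fun s => by split_ifs <;> simp [F.atom_nonneg])

/-- The part of the distribution function that comes from the atoms. -/
def atomPart (t : ℝ) : ℝ := ∑' s, if s ≤ t then F.atom s else 0

lemma atomPart_mono : Monotone F.atomPart := by
  intro s t hst
  refine (F.summable_atom_le s).tsum_le_tsum (fun r => ?_) (F.summable_atom_le t)
  by_cases h : r ≤ s
  · simp [h, h.trans hst]
  · simp only [h, if_false]
    split_ifs <;> simp [F.atom_nonneg]

lemma cdf_mono : Monotone F.cdf := fun _ _ hst =>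
  add_le_add (setIntegral_mono_set F.density_integrable.integrableOn
    (ae_of_all _ F.density_nonneg) (Iic_subset_Iic.2 hst).eventuallyLE) (F.atomPart_mono hst)

lemma cdf_eq_zero_of_not_charges {t : ℝ} (h : ∀ r ≤ t, ¬ F.Charges r) : F.cdf t = 0 := by
  have h1 : ∫ s in Iic t, F.density s = 0 :=
    setIntegral_eq_zero_of_forall_eq_zero fun s hs => (not_charges_iff.1 (h s hs)).1
  have h2 : ∀ s, (if s ≤ t then F.atom s else 0) = 0 := fun s => by
    split_ifs with hs
    exacts [(not_charges_iff.1 (h s hs)).2, rfl]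
  simp [cdf, h1, h2]

lemma cdf_of_neg {t : ℝ} (ht : t < 0) : F.cdf t = 0 :=
  F.cdf_eq_zero_of_not_charges fun _ hr => F.not_charges_of_neg (hr.trans_lt ht)

lemma cdf_nonneg (t : ℝ) : 0 ≤ F.cdf t :=
  add_nonneg (integral_nonneg F.density_nonneg)
    (tsum_nonneg fun s => by split_ifs <;> simp [F.atom_nonneg])

lemma cdf_le (t : ℝ) : F.cdf t ≤ 1 - F.never := by
  have h1 : ∫ s in Iic t, F.density s ≤ ∫ s, F.density s :=
    setIntegral_le_integral F.density_integrable (ae_of_all _ F.density_nonneg)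
  have h2 : ∑' s, (if s ≤ t then F.atom s else 0) ≤ ∑' s, F.atom s :=
    (F.summable_atom_le t).tsum_le_tsum
      (fun s => by split_ifs <;> simp [F.atom_nonneg]) F.atom_summable
  have h3 := F.total
  unfold cdf
  linarith

lemma cdf_le_one (t : ℝ) : F.cdf t ≤ 1 := by
  linarith [F.cdf_le t, F.never_nonneg]

lemma cdf_eq_of_forall_gt {t : ℝ} (h : ∀ r, t < r → ¬ F.Charges r) :
    F.cdf t = 1 - F.never := by
  have h1 : ∫ s in Iic t, F.density s = ∫ s, F.density s := by
    refine setIntegral_eq_integral_of_forall_compl_eq_zero fun s hs => ?_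
    exact (not_charges_iff.1 (h s (not_le.1 hs))).1
  have h2 : ∀ s, (if s ≤ t then F.atom s else 0) = F.atom s := fun s => by
    split_ifs with hs
    exacts [rfl, (not_charges_iff.1 (h s (not_le.1 hs))).2.symm]
  have h3 := F.total
  simp only [cdf, h1, h2]
  linarith

lemma cdf_sub {s t : ℝ} (hst : s ≤ t) :
    F.cdf t - F.cdf s = (∫ r in s..t, F.density r) +
      ∑' r, (if r ∈ Ioc s t then F.atom r else 0) := by
  have h1 := intervalIntegral.integral_Iic_sub_Iic (μ := volume) (a := s) (b := t)
    F.density_integrable.integrableOn F.density_integrable.integrableOn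
  have h2 := (F.summable_atom_le t).tsum_sub (F.summable_atom_le s)
  have h3 : (∑' r, (if r ∈ Ioc s t then F.atom r else 0)) =
      ∑' r, ((if r ≤ t then F.atom r else 0) - (if r ≤ s then F.atom r else 0)) := by
    congr 1
    ext r
    by_cases hs : r ≤ s
    · simp [hs, hs.trans hst, not_lt.2 hs]
    · simp [hs, not_le.1 hs]
  rw [h3, h2, ← h1]
  unfold cdf
  ring

lemma cdf_eq_of_not_charges {s t : ℝ} (hst : s ≤ t) (h : ∀ r ∈ Ioc s t, ¬ F.Charges r) :
    F.cdf s = F.cdf t := by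
  have h1 := F.cdf_sub hst
  have h2 : ∫ r in s..t, F.density r = 0 := by
    rw [intervalIntegral.integral_of_le hst]
    exact setIntegral_eq_zero_of_forall_eq_zero fun r hr => (not_charges_iff.1 (h r hr)).1
  have h3 : ∀ r, (if r ∈ Ioc s t then F.atom r else 0) = 0 := fun r => by
    split_ifs with hr
    exacts [(not_charges_iff.1 (h r hr)).2, rfl]
  simp only [h2, h3, tsum_zero, add_zero] at h1
  linarith

lemma exists_charges {s t : ℝ} (h : F.cdf s < F.cdf t) : ∃ r ∈ Ioc s t, F.Charges r := by
  by_contra! hc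
  have hst : s ≤ t := by
    by_contra! hts
    exact (h.trans_le (F.cdf_mono hts.le)).false
  exact h.ne (F.cdf_eq_of_not_charges hst hc)

lemma summable_atom_Ioc (s t : ℝ) : Summable fun r => if r ∈ Ioc s t then F.atom r else 0 :=
  F.atom_summable.of_nonneg_of_le (fun s => by split_ifs <;> simp [F.atom_nonneg])
    (fun s => by split_ifs <;> simp [F.atom_nonneg])

lemma cdf_add_atom_le {s t : ℝ} (hst : s < t) : F.cdf s + F.atom t ≤ F.cdf t := by
  have h1 := F.cdf_sub hst.le
  have h2 : 0 ≤ ∫ r in s..t, F.density r :=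
    intervalIntegral.integral_nonneg hst.le fun r _ => F.density_nonneg r
  have h3 := (F.summable_atom_Ioc s t).le_tsum t
    (fun r _ => by split_ifs <;> simp [F.atom_nonneg])
  simp only [right_mem_Ioc, hst, if_true] at h3
  linarith

lemma ae_density_eq_zero {s t : ℝ} (hst : s ≤ t) (h : F.cdf s = F.cdf t) :
    ∀ᵐ r, r ∈ Ioc s t → F.density r = 0 := by
  have h1 := F.cdf_sub hst
  have h2 : 0 ≤ ∫ r in s..t, F.density r :=
    intervalIntegral.integral_nonneg hst fun r _ => F.density_nonneg r
  have h3 : 0 ≤ ∑' r, (if r ∈ Ioc s t then F.atom r else 0) :=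
    tsum_nonneg fun r => by split_ifs <;> simp [F.atom_nonneg]
  have h4 : ∫ r in Ioc s t, F.density r = 0 := by
    rw [← intervalIntegral.integral_of_le hst]
    linarith
  rw [integral_eq_zero_iff_of_nonneg F.density_nonneg F.density_integrable.integrableOn] at h4
  exact (ae_restrict_iff' measurableSet_Ioc).1 h4

lemma tendsto_cdf_right (t : ℝ) : Tendsto F.cdf (𝓝[>] t) (𝓝 (F.cdf t)) := by
  refine Tendsto.add ?_ ?_
  · have hc : Continuous fun x => ∫ s in Iic x, F.density s := by
      have : (fun x => ∫ s in Iic x, F.density s) =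
          fun x => (∫ s in Iic (0 : ℝ), F.density s) + ∫ s in (0 : ℝ)..x, F.density s := by
        ext x
        rw [← intervalIntegral.integral_Iic_sub_Iic F.density_integrable.integrableOn
          F.density_integrable.integrableOn]
        ring
      rw [this]
      exact continuous_const.add
        (intervalIntegral.continuous_primitive
          (fun _ _ => F.density_integrable.intervalIntegrable) 0)
    exact (hc.tendsto t).mono_left nhdsWithin_le_nhds
  · refine tendsto_tsum_of_dominated_convergence F.atom_summable (fun s => ?_)
      (Eventually.of_forall fun x s => ?_)
    · refine tendsto_const_nhds.congr' ?_
      by_cases hs : s ≤ t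
      · filter_upwards [self_mem_nhdsWithin] with x hx
        simp [hs, hs.trans (le_of_lt hx)]
      · filter_upwards [Ioo_mem_nhdsGT (not_le.1 hs)] with x hx
        simp [hs, hx.2]
    · rw [Real.norm_eq_abs]
      split_ifs <;> simp [F.atom_nonneg, abs_of_nonneg]

/-- The strategy puts mass on some time of `[0, ∞]`. -/
lemma never_pos_or_exists_charges : 0 < F.never ∨ ∃ t, 0 ≤ t ∧ F.Charges t := by
  by_contra! h
  have h0 : F.never = 0 := le_antisymm h.1 F.never_nonneg
  have h1 : ∀ t, ¬ F.Charges t := fun t => by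
    rcases lt_or_ge t 0 with ht | ht
    exacts [F.not_charges_of_neg ht, h.2 t ht]
  have h2 := F.cdf_eq_zero_of_not_charges (t := 0) fun r _ => h1 r
  have h3 := F.cdf_eq_of_forall_gt (t := 0) fun r _ => h1 r
  linarith

/-- A strategy whose distribution function vanishes before `x`, equals `1` from `y` on, and
increases strictly in between has support exactly `[x, y]`. -/
lemma support_eq_Icc {x y : ℝ} (hxy : x < y) (h0 : ∀ t < x, F.cdf t = 0) (h1 : F.cdf y = 1)
    (hF : StrictMonoOn F.cdf (Icc x y)) : F.support = Icc x y := by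
  ext t
  simp only [support, mem_ofPred_eq]
  constructor
  · intro h
    by_contra ht
    rcases not_and_or.1 ht with ht | ht
    · have ht' := not_le.1 ht
      have := h ((x - t) / 2) (by linarith)
      rw [h0 (t + (x - t) / 2) (by linarith)] at this
      exact absurd (F.cdf_nonneg _) (not_le.2 this)
    · have ht' := not_le.1 ht
      have h2 := h (t - y) (by linarith)
      rw [sub_sub_cancel, h1] at h2
      exact absurd (F.cdf_le_one _) (not_le.2 h2)
  · rintro ⟨hx, hy⟩ ε hε
    calc F.cdf (t - ε) ≤ F.cdf (max (t - ε) x) := F.cdf_mono (le_max_left _ _)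
      _ < F.cdf (min (t + ε) y) := by
        refine hF ⟨le_max_right _ _, max_le (by linarith) hxy.le⟩
          ⟨le_min (by linarith) hxy.le, min_le_right _ _⟩ ?_
        exact max_lt (lt_min (by linarith) (by linarith)) (lt_min (by linarith) hxy)
      _ ≤ F.cdf (t + ε) := F.cdf_mono (min_le_left _ _)

/-- `V` is the value of the strategy `F` for a payoff function: no finite time yields more, and
every time of `[0, ∞]` that `F` charges yields exactly `V`. -/
structure IsValue (u : ℝ → ℝ) (uNever V : ℝ) : Prop where
  le : ∀ t, 0 ≤ t → u t ≤ V
  eq_of_charges : ∀ t, 0 ≤ t → F.Charges t → u t = V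
  eq_of_never : 0 < F.never → uNever = V

lemma Optimal.exists_isValue {F : TimeStrategy} {u : ℝ → ℝ} {uNever : ℝ}
    (h : F.Optimal u uNever) : ∃ V, F.IsValue u uNever V := by
  by_cases hc : ∃ t, 0 ≤ t ∧ F.Charges t
  · obtain ⟨t, ht, htc⟩ := hc
    refine ⟨u t, h.finite_finite t ht htc, fun s hs hsc => ?_, fun hn => ?_⟩
    · exact le_antisymm (h.finite_finite t ht htc s hs) (h.finite_finite s hs hsc t ht)
    · exact le_antisymm (h.finite_never t ht htc) (h.never_finite hn t ht)
  · have hn := F.never_pos_or_exists_charges.resolve_right hc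
    exact ⟨uNever, h.never_finite hn, fun t ht htc => absurd ⟨t, ht, htc⟩ hc, fun _ => rfl⟩

variable {F}

lemma IsValue.expect_eq {u : ℝ → ℝ} {uNever V : ℝ} (h : F.IsValue u uNever V) :
    F.expect u uNever = V := by
  have hc : ∀ t, F.Charges t → u t = V := fun t ht => by
    rcases lt_or_ge t 0 with h' | h'
    exacts [absurd ht (F.not_charges_of_neg h'), h.eq_of_charges t h' ht]
  have h1 : ∀ s, F.density s * u s = F.density s * V := fun s => by
    rcases (F.density_nonneg s).eq_or_lt with h' | h'
    · simp [← h']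
    · rw [hc s (Or.inl h')]
  have h2 : ∀ s, F.atom s * u s = F.atom s * V := fun s => by
    rcases (F.atom_nonneg s).eq_or_lt with h' | h'
    · simp [← h']
    · rw [hc s (Or.inr h')]
  have h3 : F.never * uNever = F.never * V := by
    rcases F.never_nonneg.eq_or_lt with h' | h'
    · simp [← h']
    · rw [h.eq_of_never h']
  simp only [expect, h1, h2, h3, integral_mul_const, tsum_mul_right]
  rw [← add_mul, ← add_mul, F.total, one_mul]

/-- A continuous payoff takes its maximal value on the whole support of an optimal strategy. -/
lemma IsValue.eq_of_mem_support {u : ℝ → ℝ} {uNever V : ℝ} (h : F.IsValue u uNever V)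
    (hu : ContinuousOn u (Ici 0)) {t : ℝ} (ht : 0 ≤ t) (hs : t ∈ F.support) : u t = V := by
  by_contra hne
  obtain ⟨ε, hε, hball⟩ := Metric.mem_nhdsWithin_iff.1 ((hu t ht).eventually_ne hne)
  obtain ⟨r, hr, hrc⟩ := F.exists_charges (hs (ε / 2) (by linarith))
  have hr0 : 0 ≤ r := by
    by_contra! hr0
    exact F.not_charges_of_neg hr0 hrc
  refine hball ⟨?_, hr0⟩ (h.eq_of_charges r hr0 hrc)
  rw [Metric.mem_ball, Real.dist_eq, abs_lt]
  constructor <;> linarith [hr.1, hr.2]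

lemma mem_support_of_lt {t : ℝ} (h : ∀ s < t, F.cdf s < F.cdf t) : t ∈ F.support :=
  fun ε hε => (h (t - ε) (by linarith)).trans_le (F.cdf_mono (by linarith))

/-- First time at which the distribution function reaches a given positive level. -/
lemma exists_first_time {c t : ℝ} (hc : 0 < c) (ht : c ≤ F.cdf t) :
    ∃ x, 0 ≤ x ∧ x ≤ t ∧ c ≤ F.cdf x ∧ ∀ s < x, F.cdf s < c := by
  let A := {s | c ≤ F.cdf s}
  have hA : ∀ s ∈ A, 0 ≤ s := fun s hs => by
    by_contra! h
    have hs' : c ≤ F.cdf s := hs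
    rw [F.cdf_of_neg h] at hs'
    linarith
  have hbdd : BddBelow A := ⟨0, hA⟩
  refine ⟨sInf A, le_csInf ⟨t, ht⟩ hA, csInf_le hbdd ht, ?_, fun s hs => ?_⟩
  · refine ge_of_tendsto (F.tendsto_cdf_right (sInf A)) ?_
    filter_upwards [self_mem_nhdsWithin] with x hx
    obtain ⟨s, hs, hsx⟩ := exists_lt_of_csInf_lt ⟨t, ht⟩ hx
    exact le_trans hs (F.cdf_mono hsx.le)
  · by_contra! h
    exact (csInf_le hbdd h).not_gt hs

end NewsSearch.TimeStrategy

/-! ### Integration by parts against a mixed strategy -/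

namespace NewsSearch

/-- Product rule for primitives of integrable functions. -/
lemma integral_mul_primitive_add {f₁ f₂ : ℝ → ℝ} {t : ℝ}
    (h₁ : IntervalIntegrable f₁ volume 0 t) (h₂ : IntervalIntegrable f₂ volume 0 t) :
    ∫ x in (0 : ℝ)..t, (f₁ x * (∫ s in (0 : ℝ)..x, f₂ s) + (∫ s in (0 : ℝ)..x, f₁ s) * f₂ x) =
      (∫ s in (0 : ℝ)..t, f₁ s) * ∫ s in (0 : ℝ)..t, f₂ s := by
  have a₁ := h₁.absolutelyContinuousOnInterval_intervalIntegral (c := 0) (by simp)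
  have a₂ := h₂.absolutelyContinuousOnInterval_intervalIntegral (c := 0) (by simp)
  have h := a₁.integral_deriv_mul_eq_sub a₂
  simp only [intervalIntegral.integral_same, zero_mul, sub_zero] at h
  rw [← h]
  refine intervalIntegral.integral_congr_ae ?_
  filter_upwards [h₁.ae_hasDerivAt_integral, h₂.ae_hasDerivAt_integral] with x e₁ e₂ hx
  have hx' := uIoc_subset_uIcc hx
  rw [(e₁ hx' 0 (by simp)).deriv, (e₂ hx' 0 (by simp)).deriv]

namespace TimeStrategy

variable (F : TimeStrategy)

/-- The part of the distribution function that comes from the density. -/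
def acPart (t : ℝ) : ℝ := ∫ s in (0 : ℝ)..t, F.density s

lemma cdf_eq_add (t : ℝ) : F.cdf t = F.acPart t + F.atomPart t := by
  have h1 := intervalIntegral.integral_Iic_sub_Iic (μ := volume) (a := 0) (b := t)
    F.density_integrable.integrableOn F.density_integrable.integrableOn
  have h2 : ∫ s in Iic (0 : ℝ), F.density s = 0 := by
    rw [integral_Iic_eq_integral_Iio]
    exact setIntegral_eq_zero_of_forall_eq_zero fun s hs => F.density_neg s hs
  rw [cdf, acPart, atomPart, ← h1, h2, sub_zero]

lemma countable_setOf_atom_pos : {s | 0 < F.atom s}.Countable :=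
  F.atom_summable.countable_support.mono fun _ hs => ne_of_gt hs

/-- If `m` is a primitive of `m'` on `[0, t]`, then integrating `m'` against the discrete part of
the distribution function gives the increments of `m` from each atom to `t`. -/
lemma integral_mul_atomPart {m m' : ℝ → ℝ} {t : ℝ} (ht : 0 ≤ t)
    (hm' : ContinuousOn m' (Icc 0 t))
    (hm : ∀ s ∈ Icc 0 t, m t - m s = ∫ x in s..t, m' x) :
    ∫ x in (0 : ℝ)..t, m' x * F.atomPart x =
      ∑' s, (if s ≤ t then F.atom s * (m t - m s) else 0) := by
  let A : Set ℝ := Function.support F.atom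
  have hA : A.Countable := F.atom_summable.countable_support
  have : Countable A := hA.to_subtype
  have hA0 : ∀ s ∈ A, 0 ≤ s := fun s hs => by
    by_contra! h
    exact hs (F.atom_neg s h)
  let f : A → ℝ → ℝ := fun s x => m' x * if (s : ℝ) ≤ x then F.atom s else 0
  have hint : IntegrableOn m' (Ioc 0 t) :=
    (hm'.integrableOn_compact isCompact_Icc).mono_set Ioc_subset_Icc_self
  have hf : ∀ s : A, f s = fun x => (Ici (s : ℝ)).indicator (fun x => F.atom s * m' x) x := by
    intro s
    ext x
    by_cases h : (s : ℝ) ≤ x <;> simp [f, h, mul_comm]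
  have hfi : ∀ s : A, Integrable (f s) (volume.restrict (Ioc 0 t)) := fun s => by
    rw [hf s]
    exact (hint.const_mul _).indicator measurableSet_Ici
  have hsum : Summable fun s : A => ∫ x in Ioc 0 t, ‖f s x‖ := by
    refine ((F.atom_summable.subtype A).mul_right (∫ x in Ioc 0 t, ‖m' x‖)).of_nonneg_of_le
      (fun s => integral_nonneg fun x => norm_nonneg _) fun s => ?_
    rw [← integral_const_mul]
    refine integral_mono (hfi s).norm (hint.norm.const_mul _) fun x => ?_
    have ha := F.atom_nonneg s
    simp only [f, norm_mul, Function.comp]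
    rw [mul_comm]
    refine mul_le_mul_of_nonneg_right ?_ (norm_nonneg _)
    rw [Real.norm_eq_abs]
    split_ifs <;> simp [abs_of_nonneg, ha]
  have key := integral_tsum_of_summable_integral_norm hfi hsum
  have e1 : ∀ x, ∑' s : A, f s x = m' x * F.atomPart x := by
    intro x
    simp only [f, tsum_mul_left]
    congr 1
    refine tsum_subtype_eq_of_support_subset (f := fun s => if s ≤ x then F.atom s else 0) ?_
    intro s hs h0
    simp [h0] at hs
  have e2 : ∀ s : A, ∫ x in Ioc 0 t, f s x =
      (fun s => if s ≤ t then F.atom s * (m t - m s) else 0) (s : ℝ) := by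
    intro s
    have hs0 := hA0 s s.2
    rw [hf s, integral_indicator measurableSet_Ici, Measure.restrict_restrict measurableSet_Ici,
      integral_const_mul]
    dsimp only
    by_cases hst : (s : ℝ) ≤ t
    · rw [if_pos hst, hm s ⟨hs0, hst⟩, intervalIntegral.integral_of_le hst,
        ← integral_Icc_eq_integral_Ioc]
      congr 1
      have e : Ici (s : ℝ) ∩ Icc 0 t = Icc (s : ℝ) t := by
        ext x
        exact ⟨fun h => ⟨h.1, h.2.2⟩, fun h => ⟨h.1, hs0.trans h.1, h.2⟩⟩
      rw [← e]
      refine setIntegral_congr_set ?_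
      filter_upwards [Ioc_ae_eq_Icc (a := (0 : ℝ)) (b := t) (μ := volume)] with x hx
      have hx' : x ∈ Ioc 0 t ↔ x ∈ Icc 0 t := iff_of_eq hx
      exact propext (and_congr_right fun _ => hx')
    · rw [if_neg hst]
      have : Ici (s : ℝ) ∩ Ioc 0 t = ∅ := by
        ext x
        simp only [mem_inter_iff, mem_Ici, mem_Ioc, mem_empty_iff_false, iff_false]
        intro h
        exact hst (h.1.trans h.2.2)
      simp [this]
  rw [intervalIntegral.integral_of_le ht]
  simp only [e1] at key
  rw [← key]
  simp only [e2]
  refine tsum_subtype_eq_of_support_subset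
    (f := fun s => if s ≤ t then F.atom s * (m t - m s) else 0) ?_
  intro s hs h0
  simp [h0] at hs

lemma acPart_continuous : Continuous F.acPart :=
  intervalIntegral.continuous_primitive (fun _ _ => F.density_integrable.intervalIntegrable) 0

lemma cdf_intervalIntegrable_mul {m' : ℝ → ℝ} {t : ℝ}
    (hm' : ContinuousOn m' (uIcc 0 t)) :
    IntervalIntegrable (fun x => m' x * F.cdf x) volume 0 t :=
  F.cdf_mono.intervalIntegrable.continuousOn_mul hm'

/-- Integration by parts of a continuously differentiable `m` against a mixed strategy. -/
lemma mul_cdf_eq {m m' : ℝ → ℝ} {t : ℝ} (ht : 0 ≤ t)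
    (hm' : ContinuousOn m' (Icc 0 t))
    (hm : ∀ s ∈ Icc 0 t, m s = m 0 + ∫ x in (0 : ℝ)..s, m' x) :
    m t * F.cdf t = (∫ x in (0 : ℝ)..t, (m' x * F.cdf x + m x * F.density x)) +
      ∑' s, (if s ≤ t then F.atom s * m s else 0) := by
  have hu : uIcc 0 t = Icc 0 t := uIcc_of_le ht
  have hi : IntervalIntegrable m' volume 0 t := (hu ▸ hm').intervalIntegrable
  have hd : IntervalIntegrable F.density volume 0 t := F.density_integrable.intervalIntegrable
  have hmc : ContinuousOn m (uIcc 0 t) := by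
    have : ContinuousOn (fun s => m 0 + ∫ x in (0 : ℝ)..s, m' x) (uIcc 0 t) :=
      continuousOn_const.add (intervalIntegral.continuousOn_primitive_interval'
        hi (by simp))
    exact this.congr fun s hs => hm s (hu ▸ hs)
  have hm2 : ∀ s ∈ Icc 0 t, m t - m s = ∫ x in s..t, m' x := fun s hs => by
    have hs' : IntervalIntegrable m' volume 0 s :=
      hi.mono_set (by rw [hu, uIcc_of_le hs.1]; exact Icc_subset_Icc_right hs.2)
    rw [hm s hs, hm t ⟨ht, le_rfl⟩, add_sub_add_left_eq_sub,
      intervalIntegral.integral_interval_sub_left hi hs']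
  have e1 := F.integral_mul_atomPart ht hm' hm2
  have e2 := integral_mul_primitive_add hi hd
  have i1 : IntervalIntegrable (fun x => m' x * F.acPart x) volume 0 t :=
    hi.mul_continuousOn F.acPart_continuous.continuousOn
  have i2 : IntervalIntegrable (fun x => m' x * F.atomPart x) volume 0 t :=
    F.atomPart_mono.intervalIntegrable.continuousOn_mul (hu ▸ hm')
  have i3 : IntervalIntegrable (fun x => m x * F.density x) volume 0 t :=
    hd.continuousOn_mul hmc
  have e3 : ∫ x in (0 : ℝ)..t, (m' x * F.acPart x + m x * F.density x) = m t * F.acPart t := by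
    have : ∫ x in (0 : ℝ)..t, (m' x * F.acPart x + m x * F.density x) =
        ∫ x in (0 : ℝ)..t, ((m' x * (∫ s in (0 : ℝ)..x, F.density s) +
          (∫ s in (0 : ℝ)..x, m' s) * F.density x) + m 0 * F.density x) := by
      refine intervalIntegral.integral_congr fun x hx => ?_
      simp only [acPart]
      rw [hm x (hu ▸ hx)]
      ring
    rw [this, intervalIntegral.integral_add _ (hd.const_mul _), e2,
      intervalIntegral.integral_const_mul, hm t ⟨ht, le_rfl⟩, acPart]
    · ring
    · refine i1.add (hd.continuousOn_mul ?_)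
      exact intervalIntegral.continuousOn_primitive_interval' hi (by simp)
  have e4 : ∑' s, (if s ≤ t then F.atom s * (m t - m s) else 0) =
      m t * F.atomPart t - ∑' s, (if s ≤ t then F.atom s * m s else 0) := by
    have hmc' : ContinuousOn m (Icc 0 t) := hu ▸ hmc
    obtain ⟨C, hC⟩ := isCompact_Icc.exists_bound_of_continuousOn hmc'
    have hs : Summable fun s => if s ≤ t then F.atom s * m s else 0 := by
      refine (F.atom_summable.mul_right C).of_norm_bounded fun s => ?_
      have ha := F.atom_nonneg s
      rcases lt_or_ge s 0 with h | h
      · simp [F.atom_neg s h]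
      · by_cases hst : s ≤ t
        · rw [if_pos hst, norm_mul, Real.norm_of_nonneg ha]
          exact mul_le_mul_of_nonneg_left (hC s ⟨h, hst⟩) ha
        · rw [if_neg hst, norm_zero]
          exact mul_nonneg ha ((norm_nonneg _).trans (hC 0 ⟨le_rfl, ht⟩))
    rw [atomPart, ← tsum_mul_left, ← ((F.summable_atom_le t).mul_left _).tsum_sub hs]
    congr 1
    ext s
    split_ifs <;> ring
  have e5 : ∫ x in (0 : ℝ)..t, (m' x * F.cdf x + m x * F.density x) =
      m t * F.acPart t + ∫ x in (0 : ℝ)..t, m' x * F.atomPart x := by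
    rw [← e3, ← intervalIntegral.integral_add (i1.add i3) i2]
    refine intervalIntegral.integral_congr fun x _ => ?_
    simp only [F.cdf_eq_add]
    ring
  rw [e5, e1, e4, F.cdf_eq_add]
  ring

end TimeStrategy

end NewsSearch

/-! ### The arrival of real news and the first best -/

namespace NewsSearch

namespace Game

variable (Γ : Game)

/-- Discounted probability that no real news has arrived by time `t`. -/
def disc (t : ℝ) : ℝ := Real.exp (-Γ.ρ * t) * (1 - Γ.G t)

/-- Derivative of `Game.disc`. -/
def discDeriv (t : ℝ) : ℝ := -(Real.exp (-Γ.ρ * t) * (Γ.ρ * (1 - Γ.G t) + Γ.g t))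

lemma G_zero : Γ.G 0 = 0 := by simp [G]

lemma disc_zero : Γ.disc 0 = 1 := by simp [disc, G_zero]

variable {Γ}

namespace Standing

variable (hΓ : Γ.Standing)
include hΓ

lemma μ_pos : 0 < Γ.μ := hΓ.β_pos.trans hΓ.β_lt_μ
lemma μ_lt_one : Γ.μ < 1 := hΓ.μ_lt_θ.trans hΓ.θ_lt_one
lemma θ_pos : 0 < Γ.θ := hΓ.μ_pos.trans hΓ.μ_lt_θ

lemma one_sub_G_pos {t : ℝ} (ht : 0 ≤ t) : 0 < 1 - Γ.G t := sub_pos.2 (hΓ.G_lt_one t ht)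

lemma g_intervalIntegrable {s t : ℝ} (hs : 0 ≤ s) (ht : 0 ≤ t) :
    IntervalIntegrable Γ.g volume s t :=
  (hΓ.g_cont.mono fun _ hx => (le_inf hs ht).trans hx.1).intervalIntegrable

lemma G_sub {s t : ℝ} (hs : 0 ≤ s) (ht : 0 ≤ t) : Γ.G t - Γ.G s = ∫ x in s..t, Γ.g x :=
  intervalIntegral.integral_interval_sub_left (hΓ.g_intervalIntegrable le_rfl ht)
    (hΓ.g_intervalIntegrable le_rfl hs)

lemma G_nonneg {t : ℝ} (ht : 0 ≤ t) : 0 ≤ Γ.G t :=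
  intervalIntegral.integral_nonneg ht fun x hx => hΓ.g_nonneg x hx.1

lemma G_continuousOn : ContinuousOn Γ.G (Ici 0) := by
  have h : ∀ b : ℝ, 0 ≤ b → ContinuousOn Γ.G (Icc 0 b) := fun b hb => by
    have := intervalIntegral.continuousOn_primitive_interval' (a := (0 : ℝ))
      (hΓ.g_intervalIntegrable le_rfl hb) (by simp)
    rwa [uIcc_of_le hb] at this
  intro t ht
  have ht : (0 : ℝ) ≤ t := ht
  refine (h (t + 1) (by linarith) t ⟨ht, by linarith⟩).mono_of_mem_nhdsWithin ?_
  exact inter_mem_nhdsWithin _ (Iic_mem_nhds (by linarith))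

lemma G_hasDerivAt {t : ℝ} (ht : 0 < t) : HasDerivAt Γ.G (Γ.g t) t := by
  have hc : ∀ᶠ x in 𝓝 t, ContinuousAt Γ.g x := by
    filter_upwards [Ioi_mem_nhds ht] with x hx
    exact hΓ.g_cont.continuousAt (Ici_mem_nhds hx)
  exact intervalIntegral.integral_hasDerivAt_right (hΓ.g_intervalIntegrable le_rfl ht.le)
    (ContinuousAt.stronglyMeasurableAtFilter isOpen_Ioi
      (fun x hx => hΓ.g_cont.continuousAt (Ici_mem_nhds hx)) t ht) hc.self_of_nhds

lemma hazard_continuousOn : ContinuousOn Γ.hazard (Ici 0) :=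
  hΓ.g_cont.div (continuousOn_const.sub hΓ.G_continuousOn) fun _ hx => (hΓ.one_sub_G_pos hx).ne'

lemma g_pos {t : ℝ} (ht : 0 ≤ t) : 0 < Γ.g t := by
  have h1 : Γ.hazard (t + 1) < Γ.hazard t :=
    hΓ.hazard_anti ht (by simp only [mem_Ici]; linarith) (by linarith)
  have h2 : 0 ≤ Γ.hazard (t + 1) :=
    div_nonneg (hΓ.g_nonneg _ (by linarith)) (hΓ.one_sub_G_pos (by linarith)).le
  exact (div_pos_iff_of_pos_right (hΓ.one_sub_G_pos ht)).1 (h2.trans_lt h1)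

lemma disc_pos {t : ℝ} (ht : 0 ≤ t) : 0 < Γ.disc t :=
  mul_pos (Real.exp_pos _) (hΓ.one_sub_G_pos ht)

lemma disc_continuousOn : ContinuousOn Γ.disc (Ici 0) :=
  (by fun_prop : Continuous fun t => Real.exp (-Γ.ρ * t)).continuousOn.mul
    (continuousOn_const.sub hΓ.G_continuousOn)

lemma discDeriv_continuousOn : ContinuousOn Γ.discDeriv (Ici 0) :=
  ((by fun_prop : Continuous fun t => Real.exp (-Γ.ρ * t)).continuousOn.mul
    ((continuousOn_const.mul (continuousOn_const.sub hΓ.G_continuousOn)).add hΓ.g_cont)).neg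

lemma discDeriv_intervalIntegrable {s t : ℝ} (hs : 0 ≤ s) (ht : 0 ≤ t) :
    IntervalIntegrable Γ.discDeriv volume s t :=
  (hΓ.discDeriv_continuousOn.mono fun _ hx => (le_inf hs ht).trans hx.1).intervalIntegrable

lemma disc_sub {s t : ℝ} (hs : 0 ≤ s) (hst : s ≤ t) :
    Γ.disc t - Γ.disc s = ∫ x in s..t, Γ.discDeriv x := by
  refine (intervalIntegral.integral_eq_sub_of_hasDerivAt_of_le hst
    (hΓ.disc_continuousOn.mono fun x hx => hs.trans hx.1) (fun x hx => ?_)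
    (hΓ.discDeriv_intervalIntegrable hs (hs.trans hst))).symm
  have h1 : HasDerivAt (fun t => Real.exp (-Γ.ρ * t)) (Real.exp (-Γ.ρ * x) * (-Γ.ρ)) x := by
    simpa using ((hasDerivAt_id x).const_mul (-Γ.ρ)).exp
  have h2 := h1.mul ((hΓ.G_hasDerivAt (hs.trans_lt hx.1)).const_sub 1)
  refine h2.congr_deriv ?_
  unfold discDeriv
  ring

lemma disc_eq {t : ℝ} (ht : 0 ≤ t) : Γ.disc t = 1 + ∫ x in (0 : ℝ)..t, Γ.discDeriv x := by
  rw [← hΓ.disc_sub le_rfl ht, disc_zero]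
  ring

lemma g_integrableOn : IntegrableOn Γ.g (Ioi 0) := by
  refine integrableOn_Ioi_of_intervalIntegral_norm_bounded (b := fun t : ℝ => t) (l := atTop) 1 0
    (fun t => ?_) tendsto_id ?_
  · rcases le_total 0 t with h | h
    · exact (intervalIntegrable_iff_integrableOn_Ioc_of_le h).1
        (hΓ.g_intervalIntegrable le_rfl h)
    · simp [h]
  · filter_upwards [eventually_ge_atTop 0] with t ht
    have : ∫ x in (0 : ℝ)..t, ‖Γ.g x‖ = Γ.G t := by
      refine intervalIntegral.integral_congr fun x hx => ?_
      rw [uIcc_of_le ht] at hx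
      exact Real.norm_of_nonneg (hΓ.g_nonneg x hx.1)
    rw [this]
    exact (hΓ.G_lt_one t ht).le

/-- The marginal first-best value of searching on at `t` has the sign of `H_R(t) - φ_P`. -/
lemma φP_lt_hazard_iff {t : ℝ} (ht : 0 ≤ t) :
    Γ.φP < Γ.hazard t ↔ Γ.ρ * Γ.θ * (1 - Γ.G t) < Γ.μ * (1 - Γ.θ) * Γ.g t := by
  have h1 := hΓ.one_sub_G_pos ht
  have h2 : 0 < Γ.μ * (1 - Γ.θ) := mul_pos hΓ.μ_pos (sub_pos.2 hΓ.θ_lt_one)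
  rw [φP, hazard, div_lt_div_iff₀ h2 h1, mul_comm (Γ.g t)]

lemma hazard_lt_φP_iff {t : ℝ} (ht : 0 ≤ t) :
    Γ.hazard t < Γ.φP ↔ Γ.μ * (1 - Γ.θ) * Γ.g t < Γ.ρ * Γ.θ * (1 - Γ.G t) := by
  have h1 := hΓ.one_sub_G_pos ht
  have h2 : 0 < Γ.μ * (1 - Γ.θ) := mul_pos hΓ.μ_pos (sub_pos.2 hΓ.θ_lt_one)
  rw [φP, hazard, div_lt_div_iff₀ h1 h2, mul_comm (Γ.g t)]

lemma uFBP_sub {s t : ℝ} (hs : 0 ≤ s) (hst : s ≤ t) :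
    Γ.uFBP t - Γ.uFBP s = ∫ x in s..t, Real.exp (-Γ.ρ * x) *
      (Γ.μ * (1 - Γ.θ) * Γ.g x - Γ.ρ * Γ.θ * (1 - Γ.G x)) := by
  have hf : ∀ a b : ℝ, 0 ≤ a → 0 ≤ b → IntervalIntegrable
      (fun x => Real.exp (-Γ.ρ * x) * Γ.g x * (Γ.μ + (1 - Γ.μ) * Γ.θ)) volume a b :=
    fun a b ha hb => ((hΓ.g_intervalIntegrable ha hb).continuousOn_mul
      (by fun_prop : Continuous fun t => Real.exp (-Γ.ρ * t)).continuousOn).mul_const _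
  have h1 := intervalIntegral.integral_interval_sub_left (hf 0 t le_rfl (hs.trans hst))
    (hf 0 s le_rfl hs)
  have h2 := hΓ.disc_sub hs hst
  have h3 : Γ.uFBP t - Γ.uFBP s = (∫ x in s..t, Real.exp (-Γ.ρ * x) * Γ.g x *
      (Γ.μ + (1 - Γ.μ) * Γ.θ)) + Γ.θ * ∫ x in s..t, Γ.discDeriv x := by
    rw [← h1, ← h2]
    unfold uFBP disc
    ring
  rw [h3, ← intervalIntegral.integral_const_mul, ← intervalIntegral.integral_add
    (hf s t hs (hs.trans hst)) ((hΓ.discDeriv_intervalIntegrable hs (hs.trans hst)).const_mul _)]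
  refine intervalIntegral.integral_congr fun x _ => ?_
  simp only [discDeriv]
  ring

lemma marginal_intervalIntegrable {s t : ℝ} (hs : 0 ≤ s) (ht : 0 ≤ t) :
    IntervalIntegrable (fun x => Real.exp (-Γ.ρ * x) *
      (Γ.μ * (1 - Γ.θ) * Γ.g x - Γ.ρ * Γ.θ * (1 - Γ.G x))) volume s t := by
  refine ContinuousOn.intervalIntegrable (ContinuousOn.mono (s := Ici 0) ?_
    fun _ hx => (le_inf hs ht).trans hx.1)
  exact (by fun_prop : Continuous fun t => Real.exp (-Γ.ρ * t)).continuousOn.mul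
    ((continuousOn_const.mul hΓ.g_cont).sub
      (continuousOn_const.mul (continuousOn_const.sub hΓ.G_continuousOn)))

/-- The first-best duration solves the first-order condition `H_R(τ) = φ_P`. -/
lemma hazard_eq_φP {τ : ℝ} (hτ : Γ.IsFirstBestDuration τ) : Γ.hazard τ = Γ.φP := by
  obtain ⟨h0, hmax⟩ := hτ
  rcases lt_trichotomy (Γ.hazard τ) Γ.φP with h | h | h
  · exfalso
    have hpos : 0 < τ := h0.lt_of_ne fun e => by
      rw [← e] at h
      exact (h.trans hΓ.φP_lt_hazard_zero).false
    have hc : ContinuousAt Γ.hazard τ := hΓ.hazard_continuousOn.continuousAt (Ici_mem_nhds hpos)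
    have hev : ∀ᶠ y in 𝓝[<] τ, Γ.hazard y < Γ.φP ∧ y ∈ Ioo 0 τ :=
      ((hc.eventually_lt_const h).filter_mono nhdsWithin_le_nhds).and (Ioo_mem_nhdsLT hpos)
    obtain ⟨y, hy, hy0, hyτ⟩ := hev.exists
    have h1 := hΓ.uFBP_sub hy0.le hyτ.le
    have h2 : 0 < ∫ x in y..τ, -(Real.exp (-Γ.ρ * x) *
        (Γ.μ * (1 - Γ.θ) * Γ.g x - Γ.ρ * Γ.θ * (1 - Γ.G x))) := by
      refine intervalIntegral.intervalIntegral_pos_of_pos_on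
        (hΓ.marginal_intervalIntegrable hy0.le h0).neg (fun x hx => ?_) hyτ
      have hx0 : 0 ≤ x := hy0.le.trans hx.1.le
      have := (hΓ.hazard_lt_φP_iff hx0).1 ((hΓ.hazard_anti hy0.le hx0 hx.1).trans hy)
      rw [← mul_neg]
      exact mul_pos (Real.exp_pos _) (by linarith)
    rw [intervalIntegral.integral_neg] at h2
    linarith [hmax y hy0.le]
  · exact h
  · exfalso
    have hc := (hΓ.hazard_continuousOn τ h0).mono (Ioi_subset_Ici h0)
    obtain ⟨y, hy, hyτ⟩ := ((hc.eventually_const_lt h).and self_mem_nhdsWithin).exists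
    have hyτ : τ < y := hyτ
    have h1 := hΓ.uFBP_sub h0 hyτ.le
    have h2 : 0 < ∫ x in τ..y, (Real.exp (-Γ.ρ * x) *
        (Γ.μ * (1 - Γ.θ) * Γ.g x - Γ.ρ * Γ.θ * (1 - Γ.G x))) := by
      refine intervalIntegral.intervalIntegral_pos_of_pos_on
        (hΓ.marginal_intervalIntegrable h0 (h0.trans hyτ.le)) (fun x hx => ?_) hyτ
      have hx0 : 0 ≤ x := h0.trans hx.1.le
      have := (hΓ.φP_lt_hazard_iff hx0).1
        (hy.trans (hΓ.hazard_anti hx0 (h0.trans hyτ.le : (0 : ℝ) ≤ y) hx.2))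
      exact mul_pos (Real.exp_pos _) (by linarith)
    linarith [hmax y (h0.trans hyτ.le)]

lemma search_gain_pos {τ : ℝ} (hτ : Γ.IsFirstBestDuration τ) {t : ℝ} (ht : 0 ≤ t) (htτ : t < τ) :
    Γ.ρ * Γ.θ * (1 - Γ.G t) < Γ.μ * (1 - Γ.θ) * Γ.g t :=
  (hΓ.φP_lt_hazard_iff ht).1 (hΓ.hazard_eq_φP hτ ▸ hΓ.hazard_anti ht hτ.1 htτ)

lemma search_gain_neg {τ : ℝ} (hτ : Γ.IsFirstBestDuration τ) {t : ℝ} (htτ : τ < t) :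
    Γ.μ * (1 - Γ.θ) * Γ.g t < Γ.ρ * Γ.θ * (1 - Γ.G t) :=
  (hΓ.hazard_lt_φP_iff (hτ.1.trans htτ.le)).1
    (hΓ.hazard_eq_φP hτ ▸ hΓ.hazard_anti hτ.1 (hτ.1.trans htτ.le : (0 : ℝ) ≤ t) htτ)

/-- Up to the first-best duration the agent gains from waiting for real news as long as the
principal searches on, since `H_R ≥ φ_P > φ_A`; the bound is uniform. -/
lemma wait_gain_ge {τ : ℝ} (hτ : Γ.IsFirstBestDuration τ) {t : ℝ} (ht : 0 ≤ t) (htτ : t ≤ τ) :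
    Γ.β * (1 - Γ.μ) * (Γ.φP - Γ.φA) * (1 - Γ.G t) ≤
      Γ.β * (1 - Γ.μ) * Γ.g t - Γ.ρ * Γ.μ * (1 - Γ.G t) := by
  have h1 := hΓ.one_sub_G_pos ht
  have h2 : 0 < Γ.β * (1 - Γ.μ) := mul_pos hΓ.β_pos (sub_pos.2 hΓ.μ_lt_one)
  have h3 : Γ.φP ≤ Γ.hazard t := hΓ.hazard_eq_φP hτ ▸ hΓ.hazard_anti.antitoneOn ht hτ.1 htτ
  rw [hazard, le_div_iff₀ h1] at h3
  have h4 : Γ.β * (1 - Γ.μ) * Γ.φA = Γ.ρ * Γ.μ := by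
    rw [φA, mul_div_cancel₀ _ h2.ne']
  nlinarith [mul_le_mul_of_nonneg_left h3 h2.le]

lemma wait_gain_pos {τ : ℝ} (hτ : Γ.IsFirstBestDuration τ) {t : ℝ} (ht : 0 ≤ t) (htτ : t ≤ τ) :
    0 < Γ.β * (1 - Γ.μ) * Γ.g t - Γ.ρ * Γ.μ * (1 - Γ.G t) := by
  refine lt_of_lt_of_le ?_ (hΓ.wait_gain_ge hτ ht htτ)
  exact mul_pos (mul_pos (mul_pos hΓ.β_pos (sub_pos.2 hΓ.μ_lt_one))
    (sub_pos.2 hΓ.φA_lt_φP)) (hΓ.one_sub_G_pos ht)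

/-- The discounted probability that neither real news nor the random time `F`, thinned by the
factor `c`, has arrived by time `t`. -/
lemma disc_mul_one_sub_cdf (F : TimeStrategy) (c : ℝ) {t : ℝ} (ht : 0 ≤ t) :
    Γ.disc t * (1 - c * F.cdf t) =
      1 + (∫ x in (0 : ℝ)..t,
        (Γ.discDeriv x * (1 - c * F.cdf x) - c * (Γ.disc x * F.density x))) -
      c * ∑' s, (if s ≤ t then F.atom s * Γ.disc s else 0) := by
  have hd := hΓ.discDeriv_continuousOn.mono (Icc_subset_Ici_self : Icc 0 t ⊆ Ici 0)
  have hu : uIcc 0 t = Icc 0 t := uIcc_of_le ht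
  have h := F.mul_cdf_eq ht hd (m := Γ.disc) fun s hs => by
    rw [disc_zero, hΓ.disc_eq hs.1]
  have i1 := hΓ.discDeriv_intervalIntegrable le_rfl ht
  have i2 : IntervalIntegrable (fun x => Γ.discDeriv x * F.cdf x + Γ.disc x * F.density x)
      volume 0 t := by
    refine (F.cdf_intervalIntegrable_mul (hu ▸ hd)).add
      (F.density_integrable.intervalIntegrable.continuousOn_mul ?_)
    exact hΓ.disc_continuousOn.mono (hu ▸ Icc_subset_Ici_self)
  have e : ∫ x in (0 : ℝ)..t,
      (Γ.discDeriv x * (1 - c * F.cdf x) - c * (Γ.disc x * F.density x)) =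
      (∫ x in (0 : ℝ)..t, Γ.discDeriv x) -
        c * ∫ x in (0 : ℝ)..t, (Γ.discDeriv x * F.cdf x + Γ.disc x * F.density x) := by
    rw [← intervalIntegral.integral_const_mul, ← intervalIntegral.integral_sub i1 (i2.const_mul c)]
    refine intervalIntegral.integral_congr fun x _ => ?_
    ring
  have h2 := hΓ.disc_eq ht
  rw [e]
  linear_combination h2 - c * h

end Standing

end Game

end NewsSearch

/-! ### The principal's payoff as a primitive -/

namespace NewsSearch

/-- Truncated sums of a summable family over `s ≤ t` tend to the full sum. -/
lemma tendsto_tsum_le_atTop {j : ℝ → ℝ} (hj : Summable j) :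
    Tendsto (fun t : ℝ => ∑' s, if s ≤ t then j s else 0) atTop (𝓝 (∑' s, j s)) := by
  refine tendsto_tsum_of_dominated_convergence hj.norm (fun s => ?_)
    (Eventually.of_forall fun t s => ?_)
  · refine tendsto_const_nhds.congr' ?_
    filter_upwards [eventually_ge_atTop s] with t ht
    simp [ht]
  · split_ifs <;> simp

namespace Game.Standing

variable {Γ : Game} (hΓ : Γ.Standing)
include hΓ

lemma exp_le_one {t : ℝ} (ht : 0 ≤ t) : Real.exp (-Γ.ρ * t) ≤ 1 :=
  Real.exp_le_one_iff.2 (by nlinarith [hΓ.ρ_pos])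

lemma one_sub_G_le_one {t : ℝ} (ht : 0 ≤ t) : 1 - Γ.G t ≤ 1 := by
  linarith [hΓ.G_nonneg ht]

lemma disc_le_one {t : ℝ} (ht : 0 ≤ t) : Γ.disc t ≤ 1 :=
  mul_le_one₀ (hΓ.exp_le_one ht) (hΓ.one_sub_G_pos ht).le (hΓ.one_sub_G_le_one ht)

lemma tendsto_disc : Tendsto Γ.disc atTop (𝓝 0) := by
  have h : Tendsto (fun t => Real.exp (-Γ.ρ * t)) atTop (𝓝 0) :=
    Real.tendsto_exp_atBot.comp (tendsto_id.const_mul_atTop_of_neg (neg_lt_zero.2 hΓ.ρ_pos))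
  refine squeeze_zero' ?_ ?_ h
  · filter_upwards [eventually_ge_atTop 0] with t ht using (hΓ.disc_pos ht).le
  · filter_upwards [eventually_ge_atTop 0] with t ht
    exact mul_le_of_le_one_right (Real.exp_pos _).le (hΓ.one_sub_G_le_one ht)

lemma one_sub_cdf_pos (F : TimeStrategy) (t : ℝ) : 0 < 1 - Γ.σ * F.cdf t := by
  have h1 := F.cdf_nonneg t
  have h2 := F.cdf_le_one t
  nlinarith [hΓ.σ_pos, hΓ.σ_lt_one]

lemma one_sub_cdf_le_one (F : TimeStrategy) (t : ℝ) : 1 - Γ.σ * F.cdf t ≤ 1 := by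
  nlinarith [hΓ.σ_pos, F.cdf_nonneg t]

lemma g_aemeasurable : AEMeasurable Γ.g (volume.restrict (Ioi 0)) :=
  (hΓ.g_cont.mono Ioi_subset_Ici_self).aemeasurable measurableSet_Ioi

lemma G_aemeasurable : AEMeasurable Γ.G (volume.restrict (Ioi 0)) :=
  (hΓ.G_continuousOn.mono Ioi_subset_Ici_self).aemeasurable measurableSet_Ioi

end Game.Standing

lemma TimeStrategy.density_aemeasurable (F : TimeStrategy) (s : Set ℝ) :
    AEMeasurable F.density (volume.restrict s) :=
  F.density_integrable.aemeasurable.restrict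

namespace Profile

variable (Γ : Game) (S : Profile)

/-- Density of the principal's gain from following type-1 news rather than choosing safe. -/
def gainP (s : ℝ) : ℝ := S.w1P Γ s * (S.a s * (S.belief Γ s - Γ.θ))

/-- Marginal payoff of the principal from waiting at time `s`: the gain from news, net of the cost
of delaying the safe payoff. -/
def rateP (s : ℝ) : ℝ :=
  Real.exp (-Γ.ρ * s) * (S.gainP Γ s - Γ.ρ * Γ.θ * ((1 - Γ.G s) * (1 - Γ.σ * S.FA.cdf s)))

variable {Γ} {S} (hΓ : Γ.Standing)
include hΓ

lemma w1P_pos {s : ℝ} (hs : 0 ≤ s) : 0 < S.w1P Γ s := by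
  refine add_pos_of_pos_of_nonneg ?_ ?_
  · exact mul_pos (mul_pos hΓ.μ_pos (hΓ.g_pos hs)) (hΓ.one_sub_cdf_pos _ _)
  · exact mul_nonneg (mul_nonneg hΓ.σ_pos.le (S.FA.density_nonneg s)) (hΓ.one_sub_G_pos hs).le

omit hΓ in
lemma belief_of_atom {s : ℝ} (h : 0 < S.FA.atom s) : S.belief Γ s = Γ.μ := if_pos h

lemma w1P_mul_belief_sub {s : ℝ} (hs : 0 ≤ s) (h : S.FA.atom s = 0) :
    S.w1P Γ s * (S.belief Γ s - Γ.θ) =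
      Γ.μ * (1 - Γ.θ) * Γ.g s * (1 - Γ.σ * S.FA.cdf s) -
        Γ.σ * S.FA.density s * (1 - Γ.G s) * (Γ.θ - Γ.μ) := by
  have h1 := (w1P_pos (S := S) hΓ hs).ne'
  rw [belief, if_neg (by simp [h]), ← w1P, mul_sub, mul_div_cancel₀ _ h1]
  unfold w1P
  ring

lemma belief_of_not_charges {s : ℝ} (hs : 0 ≤ s) (h : ¬ S.FA.Charges s) : S.belief Γ s = 1 := by
  obtain ⟨hd, ha⟩ := TimeStrategy.not_charges_iff.1 h
  have h1 := w1P_mul_belief_sub (S := S) hΓ hs ha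
  have h2 := w1P_pos (S := S) hΓ hs
  have h3 : S.w1P Γ s = Γ.μ * Γ.g s * (1 - Γ.σ * S.FA.cdf s) := by simp [w1P, hd]
  rw [hd] at h1
  have h4 : S.w1P Γ s * (S.belief Γ s - Γ.θ) = S.w1P Γ s * (1 - Γ.θ) := by
    rw [h1, h3]
    ring
  linarith [mul_left_cancel₀ h2.ne' h4]

lemma belief_aemeasurable : AEMeasurable (S.belief Γ) (volume.restrict (Ioi 0)) := by
  have hg := hΓ.g_aemeasurable
  have hG := hΓ.G_aemeasurable
  have hF : AEMeasurable S.FA.cdf (volume.restrict (Ioi 0)) :=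
    S.FA.cdf_mono.measurable.aemeasurable
  have hd := S.FA.density_aemeasurable (Ioi 0)
  have h : AEMeasurable (fun s => (Γ.μ * Γ.g s * (1 - Γ.σ * S.FA.cdf s) +
      Γ.μ * Γ.σ * S.FA.density s * (1 - Γ.G s)) /
      (Γ.μ * Γ.g s * (1 - Γ.σ * S.FA.cdf s) + Γ.σ * S.FA.density s * (1 - Γ.G s)))
      (volume.restrict (Ioi 0)) := by fun_prop
  refine h.congr (ae_restrict_of_ae ?_)
  filter_upwards [S.FA.countable_setOf_atom_pos.ae_notMem volume] with s hs
  exact (if_neg hs).symm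

/-! #### Best responses to news -/

variable (hS : S.IsEquilibrium Γ)
include hS

lemma a_eq_zero_of_atom {s : ℝ} (hs : 0 ≤ s) (h : 0 < S.FA.atom s) : S.a s = 0 :=
  hS.safe s hs (belief_of_atom (Γ := Γ) h ▸ hΓ.μ_lt_θ)

lemma a_eq_one_of_not_charges {s : ℝ} (hs : 0 ≤ s) (h : ¬ S.FA.Charges s) : S.a s = 1 :=
  hS.risky s hs (belief_of_not_charges hΓ hs h ▸ hΓ.θ_lt_one)

omit hΓ in
lemma gainP_eq_zero {s : ℝ} (hs : 0 ≤ s) (h : S.a s ≠ 1) : S.gainP Γ s = 0 := by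
  rcases lt_trichotomy (S.belief Γ s) Γ.θ with hb | hb | hb
  · simp [gainP, hS.safe s hs hb]
  · simp [gainP, hb]
  · exact absurd (hS.risky s hs hb) h

lemma gainP_nonneg {s : ℝ} (hs : 0 ≤ s) : 0 ≤ S.gainP Γ s := by
  by_cases h : S.a s = 1
  · rw [gainP, h, one_mul]
    refine mul_nonneg (w1P_pos hΓ hs).le (sub_nonneg.2 ?_)
    by_contra! hb
    linarith [hS.safe s hs hb]
  · rw [gainP_eq_zero hS hs h]

lemma gainP_le {s : ℝ} (hs : 0 ≤ s) :
    S.gainP Γ s ≤ Γ.μ * (1 - Γ.θ) * Γ.g s * (1 - Γ.σ * S.FA.cdf s) := by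
  have h0 : 0 ≤ Γ.μ * (1 - Γ.θ) * Γ.g s * (1 - Γ.σ * S.FA.cdf s) :=
    mul_nonneg (mul_nonneg (mul_nonneg hΓ.μ_pos.le (sub_pos.2 hΓ.θ_lt_one).le)
      (hΓ.g_nonneg s hs)) (hΓ.one_sub_cdf_pos _ _).le
  by_cases h : S.a s = 1
  · have ha : S.FA.atom s = 0 := by
      rcases (S.FA.atom_nonneg s).eq_or_lt with h' | h'
      · exact h'.symm
      · linarith [a_eq_zero_of_atom hΓ hS hs h']
    rw [gainP, h, one_mul, w1P_mul_belief_sub hΓ hs ha, sub_le_self_iff]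
    exact mul_nonneg (mul_nonneg (mul_nonneg hΓ.σ_pos.le (S.FA.density_nonneg s))
      (hΓ.one_sub_G_pos hs).le) (sub_nonneg.2 hΓ.μ_lt_θ.le)
  · rwa [gainP_eq_zero hS hs h]

lemma gainP_of_not_charges {s : ℝ} (hs : 0 ≤ s) (h : ¬ S.FA.Charges s) :
    S.gainP Γ s = Γ.μ * (1 - Γ.θ) * Γ.g s * (1 - Γ.σ * S.FA.cdf s) := by
  obtain ⟨hd, ha⟩ := TimeStrategy.not_charges_iff.1 h
  rw [gainP, a_eq_one_of_not_charges hΓ hS hs h, one_mul, w1P_mul_belief_sub hΓ hs ha, hd]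
  ring

/-! #### Integral formula -/

omit hS in
lemma gainP_aemeasurable : AEMeasurable (S.gainP Γ) (volume.restrict (Ioi 0)) := by
  have hg := hΓ.g_aemeasurable
  have hG := hΓ.G_aemeasurable
  have hF : AEMeasurable S.FA.cdf (volume.restrict (Ioi 0)) :=
    S.FA.cdf_mono.measurable.aemeasurable
  have hd := S.FA.density_aemeasurable (Ioi 0)
  have hb := belief_aemeasurable (S := S) hΓ
  have ha := S.a_measurable.aemeasurable (μ := volume.restrict (Ioi (0 : ℝ)))
  unfold gainP w1P
  fun_prop

lemma flowP_integrableOn : IntegrableOn (S.flowP Γ) (Ioi 0) := by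
  have hg := hΓ.g_aemeasurable
  have hG := hΓ.G_aemeasurable
  have hF : AEMeasurable S.FA.cdf (volume.restrict (Ioi 0)) :=
    S.FA.cdf_mono.measurable.aemeasurable
  have hd := S.FA.density_aemeasurable (Ioi 0)
  have hgain := gainP_aemeasurable (S := S) hΓ
  have e : S.flowP Γ = fun s => Real.exp (-Γ.ρ * s) *
      ((Γ.g s * (1 - Γ.σ * S.FA.cdf s) + Γ.σ * S.FA.density s * (1 - Γ.G s)) * Γ.θ +
        S.gainP Γ s) := by
    ext s
    simp only [flowP, w0P, news1P, gainP, w1P]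
    ring
  have hm : AEMeasurable (S.flowP Γ) (volume.restrict (Ioi 0)) := by
    rw [e]
    fun_prop
  refine Integrable.mono' ((hΓ.g_integrableOn.const_mul 2).add
    S.FA.density_integrable.integrableOn) hm.aestronglyMeasurable ?_
  refine (ae_restrict_iff' measurableSet_Ioi).2 (ae_of_all _ fun s hs => ?_)
  have hs : 0 ≤ s := le_of_lt hs
  have h1 := gainP_nonneg hΓ hS hs
  have h2 := gainP_le hΓ hS hs
  have hg0 := hΓ.g_nonneg s hs
  have hd0 := S.FA.density_nonneg s
  have hq0 := hΓ.one_sub_cdf_pos S.FA s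
  have hq1 := hΓ.one_sub_cdf_le_one S.FA s
  have hG0 := hΓ.one_sub_G_pos hs
  have hG1 := hΓ.one_sub_G_le_one hs
  have hσ := hΓ.σ_pos
  have hgq : Γ.g s * (1 - Γ.σ * S.FA.cdf s) ≤ Γ.g s := mul_le_of_le_one_right hg0 hq1
  have hgq0 : 0 ≤ Γ.g s * (1 - Γ.σ * S.FA.cdf s) := mul_nonneg hg0 hq0.le
  have hσd0 : 0 ≤ Γ.σ * S.FA.density s := mul_nonneg hσ.le hd0
  have hσd : Γ.σ * S.FA.density s * (1 - Γ.G s) ≤ S.FA.density s :=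
    (mul_le_of_le_one_right hσd0 hG1).trans (mul_le_of_le_one_left hd0 hΓ.σ_lt_one.le)
  have hdG0 : 0 ≤ Γ.σ * S.FA.density s * (1 - Γ.G s) := mul_nonneg hσd0 hG0.le
  have hgain : S.gainP Γ s ≤ Γ.g s := by
    refine h2.trans ?_
    have hc : Γ.μ * (1 - Γ.θ) ≤ 1 := mul_le_one₀ hΓ.μ_lt_one.le
      (sub_pos.2 hΓ.θ_lt_one).le (by linarith [hΓ.θ_pos])
    rw [mul_assoc]
    exact (mul_le_of_le_one_left hgq0 hc).trans hgq
  have hX : (Γ.g s * (1 - Γ.σ * S.FA.cdf s) + Γ.σ * S.FA.density s * (1 - Γ.G s)) * Γ.θ ≤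
      Γ.g s * (1 - Γ.σ * S.FA.cdf s) + Γ.σ * S.FA.density s * (1 - Γ.G s) :=
    mul_le_of_le_one_right (add_nonneg hgq0 hdG0) hΓ.θ_lt_one.le
  have hX0 : 0 ≤ (Γ.g s * (1 - Γ.σ * S.FA.cdf s) +
      Γ.σ * S.FA.density s * (1 - Γ.G s)) * Γ.θ :=
    mul_nonneg (add_nonneg hgq0 hdG0) hΓ.θ_pos.le
  simp only [e, Pi.add_apply]
  rw [norm_mul, Real.norm_of_nonneg (Real.exp_pos _).le, Real.norm_of_nonneg (by linarith)]
  refine (mul_le_of_le_one_left (by linarith) (hΓ.exp_le_one hs)).trans ?_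
  linarith

lemma jumpP_eq (s : ℝ) : S.jumpP Γ s = Γ.σ * Γ.θ * (S.FA.atom s * Γ.disc s) := by
  rcases (S.FA.atom_nonneg s).eq_or_lt with h | h
  · simp [jumpP, w1PAtom, ← h]
  · have hs : 0 ≤ s := by
      by_contra! hs
      exact h.ne' (S.FA.atom_neg s hs)
    rw [jumpP, w1PAtom, news1P, a_eq_zero_of_atom hΓ hS hs h, Game.disc]
    ring

omit hS in
lemma summable_atom_mul_disc (F : TimeStrategy) : Summable fun s => F.atom s * Γ.disc s := by
  refine F.atom_summable.of_norm_bounded fun s => ?_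
  rcases lt_or_ge s 0 with h | h
  · simp [F.atom_neg s h]
  · rw [norm_mul, Real.norm_of_nonneg (F.atom_nonneg s), Real.norm_of_nonneg (hΓ.disc_pos h).le]
    exact mul_le_of_le_one_right (F.atom_nonneg s) (hΓ.disc_le_one h)

lemma flowP_intervalIntegrable {t : ℝ} (ht : 0 ≤ t) :
    IntervalIntegrable (S.flowP Γ) volume 0 t :=
  (intervalIntegrable_iff_integrableOn_Ioc_of_le ht).2
    ((flowP_integrableOn hΓ hS).mono_set Ioc_subset_Ioi_self)

omit hS in
lemma discDeriv_cdf_intervalIntegrable (F : TimeStrategy) (c : ℝ) {t : ℝ} (ht : 0 ≤ t) :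
    IntervalIntegrable (fun x => Γ.discDeriv x * (1 - c * F.cdf x) - c * (Γ.disc x * F.density x))
      volume 0 t := by
  have hu : uIcc 0 t ⊆ Ici 0 := uIcc_of_le ht ▸ Icc_subset_Ici_self
  have i1 : IntervalIntegrable (fun x => 1 - c * F.cdf x) volume 0 t :=
    (intervalIntegrable_const (c := (1 : ℝ))).sub (F.cdf_mono.intervalIntegrable.const_mul c)
  exact (i1.continuousOn_mul (hΓ.discDeriv_continuousOn.mono hu)).sub
    ((F.density_integrable.intervalIntegrable.continuousOn_mul
      (hΓ.disc_continuousOn.mono hu)).const_mul c)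

omit hΓ hS in
lemma flowP_add_eq_rateP (x : ℝ) : S.flowP Γ x + Γ.θ * (Γ.discDeriv x * (1 - Γ.σ * S.FA.cdf x) -
    Γ.σ * (Γ.disc x * S.FA.density x)) = S.rateP Γ x := by
  simp only [flowP, w0P, news1P, rateP, gainP, w1P, Game.discDeriv, Game.disc]
  ring

lemma rateP_intervalIntegrable {s t : ℝ} (hs : 0 ≤ s) (ht : 0 ≤ t) :
    IntervalIntegrable (S.rateP Γ) volume s t := by
  have h : ∀ t : ℝ, 0 ≤ t → IntervalIntegrable (S.rateP Γ) volume 0 t := fun t ht =>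
    ((flowP_intervalIntegrable hΓ hS ht).add
      ((discDeriv_cdf_intervalIntegrable hΓ S.FA Γ.σ ht).const_mul Γ.θ)).congr
      (fun x _ => flowP_add_eq_rateP x)
  exact (h s hs).symm.trans (h t ht)

/-- Atoms of the faking strategy drop out of the principal's payoff, since she chooses safe there:
the payoff is a primitive of `Profile.rateP`. -/
lemma uP_eq {t : ℝ} (ht : 0 ≤ t) : S.uP Γ t = Γ.θ + ∫ s in (0 : ℝ)..t, S.rateP Γ s := by
  have h1 := hΓ.disc_mul_one_sub_cdf S.FA Γ.σ ht
  have h2 : ∫ s in (0 : ℝ)..t, S.rateP Γ s = (∫ s in (0 : ℝ)..t, S.flowP Γ s) +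
      Γ.θ * ∫ x in (0 : ℝ)..t, (Γ.discDeriv x * (1 - Γ.σ * S.FA.cdf x) -
        Γ.σ * (Γ.disc x * S.FA.density x)) := by
    rw [← intervalIntegral.integral_const_mul, ← intervalIntegral.integral_add
      (flowP_intervalIntegrable hΓ hS ht)
      ((discDeriv_cdf_intervalIntegrable hΓ S.FA Γ.σ ht).const_mul Γ.θ)]
    exact intervalIntegral.integral_congr fun x _ => (flowP_add_eq_rateP x).symm
  have h3 : ∑' s, (if s ≤ t then S.jumpP Γ s else 0) =
      Γ.σ * Γ.θ * ∑' s, (if s ≤ t then S.FA.atom s * Γ.disc s else 0) := by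
    rw [← tsum_mul_left]
    congr 1
    ext s
    split_ifs
    · exact jumpP_eq hΓ hS s
    · simp
  rw [uP, h2, h3, WP, ← mul_assoc (Real.exp _), ← Game.disc]
  linear_combination Γ.θ * h1

lemma uP_zero : S.uP Γ 0 = Γ.θ := by simp [uP_eq hΓ hS le_rfl]

lemma uP_sub {s t : ℝ} (hs : 0 ≤ s) (ht : 0 ≤ t) :
    S.uP Γ t - S.uP Γ s = ∫ x in s..t, S.rateP Γ x := by
  rw [uP_eq hΓ hS hs, uP_eq hΓ hS ht, add_sub_add_left_eq_sub,
    intervalIntegral.integral_interval_sub_left (rateP_intervalIntegrable hΓ hS le_rfl ht)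
      (rateP_intervalIntegrable hΓ hS le_rfl hs)]

lemma uP_continuousOn : ContinuousOn (S.uP Γ) (Ici 0) := by
  have h : ∀ b : ℝ, 0 ≤ b → ContinuousOn (S.uP Γ) (Icc 0 b) := fun b hb => by
    have := intervalIntegral.continuousOn_primitive_interval' (a := (0 : ℝ))
      (rateP_intervalIntegrable hΓ hS le_rfl hb) (by simp)
    rw [uIcc_of_le hb] at this
    exact (continuousOn_const.add this).congr fun x hx => uP_eq hΓ hS hx.1
  intro t ht
  have ht : (0 : ℝ) ≤ t := ht
  refine (h (t + 1) (by linarith) t ⟨ht, by linarith⟩).mono_of_mem_nhdsWithin ?_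
  exact inter_mem_nhdsWithin _ (Iic_mem_nhds (by linarith))

lemma tendsto_uP : Tendsto (S.uP Γ) atTop (𝓝 (S.uPNever Γ)) := by
  have h1 := intervalIntegral_tendsto_integral_Ioi 0 (flowP_integrableOn hΓ hS) tendsto_id
  have hj : Summable (S.jumpP Γ) := by
    simp only [funext (jumpP_eq hΓ hS)]
    exact (summable_atom_mul_disc hΓ S.FA).mul_left _
  have h3 : Tendsto (fun t => Real.exp (-Γ.ρ * t) * S.WP Γ t * Γ.θ) atTop (𝓝 0) := by
    refine squeeze_zero' ?_ ?_ hΓ.tendsto_disc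
    · filter_upwards [eventually_ge_atTop 0] with t ht
      exact mul_nonneg (mul_nonneg (Real.exp_pos _).le (mul_nonneg (hΓ.one_sub_G_pos ht).le
        (hΓ.one_sub_cdf_pos _ _).le)) hΓ.θ_pos.le
    · filter_upwards [eventually_ge_atTop 0] with t ht
      rw [WP, ← mul_assoc, ← Game.disc, mul_assoc]
      exact mul_le_of_le_one_right (hΓ.disc_pos ht).le (mul_le_one₀ (hΓ.one_sub_cdf_le_one _ _)
        hΓ.θ_pos.le hΓ.θ_lt_one.le)
  have h := (h1.add (tendsto_tsum_le_atTop hj)).add h3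
  rw [add_zero] at h
  exact h

/-! #### Monotonicity of the principal's payoff -/

/-- Where the principal does not surely follow type-1 news, waiting has no benefit. -/
lemma uP_lt_of_a_ne_one {s t : ℝ} (hs : 0 ≤ s) (hst : s < t) (h : ∀ x ∈ Ioo s t, S.a x ≠ 1) :
    S.uP Γ t < S.uP Γ s := by
  have h1 := uP_sub hΓ hS hs (hs.trans hst.le)
  have h2 : 0 < ∫ x in s..t, -S.rateP Γ x := by
    refine intervalIntegral.intervalIntegral_pos_of_pos_on
      (rateP_intervalIntegrable hΓ hS hs (hs.trans hst.le)).neg (fun x hx => ?_) hst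
    have hx0 : 0 ≤ x := hs.trans hx.1.le
    rw [rateP, gainP_eq_zero hS hx0 (h x hx), ← mul_neg, zero_sub, neg_neg]
    exact mul_pos (Real.exp_pos _) (mul_pos (mul_pos hΓ.ρ_pos hΓ.θ_pos)
      (mul_pos (hΓ.one_sub_G_pos hx0) (hΓ.one_sub_cdf_pos _ _)))
  rw [intervalIntegral.integral_neg] at h2
  linarith

/-- Past the first-best duration waiting does not pay, even if all news is real. -/
lemma uP_lt_of_firstBest_le {τ : ℝ} (hτ : Γ.IsFirstBestDuration τ) {s t : ℝ} (hs : τ ≤ s)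
    (hst : s < t) : S.uP Γ t < S.uP Γ s := by
  have hs0 := hτ.1.trans hs
  have h1 := uP_sub hΓ hS hs0 (hs0.trans hst.le)
  have h2 : 0 < ∫ x in s..t, -S.rateP Γ x := by
    refine intervalIntegral.intervalIntegral_pos_of_pos_on
      (rateP_intervalIntegrable hΓ hS hs0 (hs0.trans hst.le)).neg (fun x hx => ?_) hst
    have hx0 : 0 ≤ x := hs0.trans hx.1.le
    have e1 := gainP_le hΓ hS hx0
    have e2 := mul_lt_mul_of_pos_right (hΓ.search_gain_neg hτ (hs.trans_lt hx.1))
      (hΓ.one_sub_cdf_pos S.FA x)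
    rw [rateP, ← mul_neg]
    exact mul_pos (Real.exp_pos _) (by linarith)
  rw [intervalIntegral.integral_neg] at h2
  linarith

/-- Before the first-best duration waiting pays as long as all news is real. -/
lemma uP_lt_of_ae_not_charges {τ : ℝ} (hτ : Γ.IsFirstBestDuration τ) {s t : ℝ} (hs : 0 ≤ s)
    (hst : s < t) (htτ : t ≤ τ) (h : ∀ᵐ x, x ∈ Ioc s t → ¬ S.FA.Charges x) :
    S.uP Γ s < S.uP Γ t := by
  have h1 := uP_sub hΓ hS hs (hs.trans hst.le)
  have h2 : ∫ x in s..t, S.rateP Γ x = ∫ x in s..t, Real.exp (-Γ.ρ * x) *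
      ((Γ.μ * (1 - Γ.θ) * Γ.g x - Γ.ρ * Γ.θ * (1 - Γ.G x)) * (1 - Γ.σ * S.FA.cdf x)) := by
    refine intervalIntegral.integral_congr_ae ?_
    filter_upwards [h] with x hx hxm
    rw [uIoc_of_le hst.le] at hxm
    rw [rateP, gainP_of_not_charges hΓ hS (hs.trans hxm.1.le) (hx hxm)]
    ring
  have h3 : 0 < ∫ x in s..t, Real.exp (-Γ.ρ * x) *
      ((Γ.μ * (1 - Γ.θ) * Γ.g x - Γ.ρ * Γ.θ * (1 - Γ.G x)) * (1 - Γ.σ * S.FA.cdf x)) := by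
    refine intervalIntegral.intervalIntegral_pos_of_pos_on ?_ (fun x hx => ?_) hst
    · have i1 : IntervalIntegrable (fun x => 1 - Γ.σ * S.FA.cdf x) volume s t :=
        (intervalIntegrable_const (c := (1 : ℝ))).sub
          (S.FA.cdf_mono.intervalIntegrable.const_mul _)
      have hu : uIcc s t ⊆ Ici 0 := fun x hx => (le_inf hs (hs.trans hst.le)).trans hx.1
      refine (i1.continuousOn_mul ?_).continuousOn_mul
        (by fun_prop : Continuous fun t => Real.exp (-Γ.ρ * t)).continuousOn
      exact ((continuousOn_const.mul hΓ.g_cont).sub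
        (continuousOn_const.mul (continuousOn_const.sub hΓ.G_continuousOn))).mono hu
    · have hx0 : 0 ≤ x := hs.trans hx.1.le
      exact mul_pos (Real.exp_pos _) (mul_pos (sub_pos.2
        (hΓ.search_gain_pos hτ hx0 (hx.2.trans_le htτ))) (hΓ.one_sub_cdf_pos _ _))
  linarith

end Profile

end NewsSearch

/-! ### The agent's payoff -/

namespace NewsSearch

namespace Profile

variable (Γ : Game) (S : Profile)

/-- Marginal payoff of the agent from waiting at time `s`, when the alternative is that the
principal chooses safe. -/
def rateA (s : ℝ) : ℝ :=
  Real.exp (-Γ.ρ * s) * ((1 - S.FP.cdf s) *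
    (Γ.μ * (1 - Γ.β) * (S.a s * Γ.g s) - Γ.ρ * Γ.β * (1 - Γ.G s)))

/-- The agent's payoff of faking at `t` if that fake news leads to the safe action. -/
def ignoredA (t : ℝ) : ℝ := Γ.β + ∫ s in (0 : ℝ)..t, S.rateA Γ s

/-- The agent's payoff of faking at `t` if that fake news leads to the risky action. -/
def followedA (t : ℝ) : ℝ :=
  S.ignoredA Γ t + Γ.disc t * (1 - S.FP.cdf t) * (Γ.μ - Γ.β)

variable {Γ} {S} (hΓ : Γ.Standing)
include hΓ

lemma flowA_integrableOn : IntegrableOn (S.flowA Γ) (Ioi 0) := by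
  have hg := hΓ.g_aemeasurable
  have hG := hΓ.G_aemeasurable
  have hF : AEMeasurable S.FP.cdf (volume.restrict (Ioi 0)) :=
    S.FP.cdf_mono.measurable.aemeasurable
  have hd := S.FP.density_aemeasurable (Ioi 0)
  have ha := S.a_measurable.aemeasurable (μ := volume.restrict (Ioi (0 : ℝ)))
  have hm : AEMeasurable (S.flowA Γ) (volume.restrict (Ioi 0)) := by
    unfold flowA w0A w1A wSA
    fun_prop
  refine Integrable.mono' (hΓ.g_integrableOn.add S.FP.density_integrable.integrableOn)
    hm.aestronglyMeasurable ?_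
  refine (ae_restrict_iff' measurableSet_Ioi).2 (ae_of_all _ fun s hs => ?_)
  have hs : 0 ≤ s := le_of_lt hs
  have hg0 := hΓ.g_nonneg s hs
  have hd0 := S.FP.density_nonneg s
  have hF0 : 0 ≤ 1 - S.FP.cdf s := sub_nonneg.2 (S.FP.cdf_le_one s)
  have hF1 : 1 - S.FP.cdf s ≤ 1 := by linarith [S.FP.cdf_nonneg s]
  have hG0 := hΓ.one_sub_G_pos hs
  have hG1 := hΓ.one_sub_G_le_one hs
  have hβ0 := hΓ.β_pos
  have hβ1 : Γ.β < 1 := hΓ.β_lt_μ.trans hΓ.μ_lt_one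
  have hμ0 := hΓ.μ_pos
  have hμ1 := hΓ.μ_lt_one
  have ha0 := S.a_nonneg s hs
  have ha1 := S.a_le_one s hs
  have hr0 : 0 ≤ (1 - S.a s) * Γ.β + S.a s :=
    add_nonneg (mul_nonneg (sub_nonneg.2 ha1) hβ0.le) ha0
  have hr1 : (1 - S.a s) * Γ.β + S.a s ≤ 1 := by nlinarith
  have hx0 : 0 ≤ Γ.g s * (1 - S.FP.cdf s) := mul_nonneg hg0 hF0
  have hx1 : Γ.g s * (1 - S.FP.cdf s) ≤ Γ.g s := mul_le_of_le_one_right hg0 hF1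
  have h1 : 0 ≤ S.w0A Γ s * Γ.β ∧ S.w0A Γ s * Γ.β ≤ (1 - Γ.μ) * Γ.g s := by
    have e : S.w0A Γ s = (1 - Γ.μ) * (Γ.g s * (1 - S.FP.cdf s)) := by unfold w0A; ring
    have e0 : 0 ≤ S.w0A Γ s := e ▸ mul_nonneg (sub_nonneg.2 hμ1.le) hx0
    refine ⟨mul_nonneg e0 hβ0.le, (mul_le_of_le_one_right e0 hβ1.le).trans ?_⟩
    rw [e]
    exact mul_le_mul_of_nonneg_left hx1 (sub_nonneg.2 hμ1.le)
  have h2 : 0 ≤ S.w1A Γ s * ((1 - S.a s) * Γ.β + S.a s) ∧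
      S.w1A Γ s * ((1 - S.a s) * Γ.β + S.a s) ≤ Γ.μ * Γ.g s := by
    have e : S.w1A Γ s = Γ.μ * (Γ.g s * (1 - S.FP.cdf s)) := by unfold w1A; ring
    have e0 : 0 ≤ S.w1A Γ s := e ▸ mul_nonneg hμ0.le hx0
    refine ⟨mul_nonneg e0 hr0, (mul_le_of_le_one_right e0 hr1).trans ?_⟩
    rw [e]
    exact mul_le_mul_of_nonneg_left hx1 hμ0.le
  have h3 : 0 ≤ S.wSA Γ s * Γ.β ∧ S.wSA Γ s * Γ.β ≤ S.FP.density s := by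
    have e0 : 0 ≤ S.wSA Γ s := mul_nonneg hd0 hG0.le
    exact ⟨mul_nonneg e0 hβ0.le, (mul_le_of_le_one_right e0 hβ1.le).trans
      (mul_le_of_le_one_right hd0 hG1)⟩
  simp only [Pi.add_apply]
  rw [flowA, norm_mul, Real.norm_of_nonneg (Real.exp_pos _).le, Real.norm_of_nonneg (by linarith)]
  refine (mul_le_of_le_one_left (by linarith) (hΓ.exp_le_one hs)).trans ?_
  linarith

lemma flowA_intervalIntegrable {t : ℝ} (ht : 0 ≤ t) :
    IntervalIntegrable (S.flowA Γ) volume 0 t :=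
  (intervalIntegrable_iff_integrableOn_Ioc_of_le ht).2
    ((flowA_integrableOn hΓ).mono_set Ioc_subset_Ioi_self)

omit hΓ in
lemma flowA_add_eq_rateA (x : ℝ) : S.flowA Γ x + Γ.β * (Γ.discDeriv x * (1 - 1 * S.FP.cdf x) -
    1 * (Γ.disc x * S.FP.density x)) = S.rateA Γ x := by
  simp only [flowA, w0A, w1A, wSA, rateA, Game.discDeriv, Game.disc]
  ring

lemma rateA_intervalIntegrable {s t : ℝ} (hs : 0 ≤ s) (ht : 0 ≤ t) :
    IntervalIntegrable (S.rateA Γ) volume s t := by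
  have h : ∀ t : ℝ, 0 ≤ t → IntervalIntegrable (S.rateA Γ) volume 0 t := fun t ht =>
    ((flowA_intervalIntegrable hΓ ht).add
      ((discDeriv_cdf_intervalIntegrable hΓ S.FP 1 ht).const_mul Γ.β)).congr
      (fun x _ => flowA_add_eq_rateA x)
  exact (h s hs).symm.trans (h t ht)

omit hΓ in
lemma jumpA_eq (s : ℝ) : S.jumpA Γ s = Γ.β * (S.FP.atom s * Γ.disc s) := by
  rw [jumpA, wSAAtom, Game.disc]
  ring

lemma ignoredA_eq {t : ℝ} (ht : 0 ≤ t) : S.ignoredA Γ t =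
    (∫ s in (0 : ℝ)..t, S.flowA Γ s) + (∑' s, (if s ≤ t then S.jumpA Γ s else 0)) +
      Γ.β * (Γ.disc t * (1 - S.FP.cdf t)) := by
  have h1 := hΓ.disc_mul_one_sub_cdf S.FP 1 ht
  have h2 : ∫ s in (0 : ℝ)..t, S.rateA Γ s = (∫ s in (0 : ℝ)..t, S.flowA Γ s) +
      Γ.β * ∫ x in (0 : ℝ)..t, (Γ.discDeriv x * (1 - 1 * S.FP.cdf x) -
        1 * (Γ.disc x * S.FP.density x)) := by
    rw [← intervalIntegral.integral_const_mul, ← intervalIntegral.integral_add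
      (flowA_intervalIntegrable hΓ ht)
      ((discDeriv_cdf_intervalIntegrable hΓ S.FP 1 ht).const_mul Γ.β)]
    exact intervalIntegral.integral_congr fun x _ => (flowA_add_eq_rateA x).symm
  have h3 : ∑' s, (if s ≤ t then S.jumpA Γ s else 0) =
      Γ.β * ∑' s, (if s ≤ t then S.FP.atom s * Γ.disc s else 0) := by
    rw [← tsum_mul_left]
    congr 1
    ext s
    split_ifs
    · exact jumpA_eq s
    · simp
  rw [ignoredA, h2, h3]
  linear_combination -Γ.β * h1

lemma uA_eq {t : ℝ} (ht : 0 ≤ t) : S.uA Γ t =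
    S.ignoredA Γ t + Γ.disc t * (1 - S.FP.cdf t) * (S.a t * (Γ.μ - Γ.β)) := by
  rw [ignoredA_eq hΓ ht, uA, WA, Game.disc]
  ring

lemma uA_eq_followedA {t : ℝ} (ht : 0 ≤ t) (ha : S.a t = 1) : S.uA Γ t = S.followedA Γ t := by
  rw [uA_eq hΓ ht, ha, one_mul, followedA]

lemma tendsto_ignoredA : Tendsto (S.ignoredA Γ) atTop (𝓝 (S.uANever Γ)) := by
  have h1 := intervalIntegral_tendsto_integral_Ioi 0 (flowA_integrableOn (S := S) hΓ) tendsto_id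
  have hj : Summable (S.jumpA Γ) := by
    simp only [funext (jumpA_eq (S := S) (Γ := Γ))]
    exact (summable_atom_mul_disc hΓ S.FP).mul_left _
  have h3 : Tendsto (fun t => Γ.β * (Γ.disc t * (1 - S.FP.cdf t))) atTop (𝓝 0) := by
    rw [← mul_zero Γ.β]
    refine Tendsto.const_mul _ (squeeze_zero' ?_ ?_ hΓ.tendsto_disc)
    · filter_upwards [eventually_ge_atTop 0] with t ht
      exact mul_nonneg (hΓ.disc_pos ht).le (sub_nonneg.2 (S.FP.cdf_le_one t))
    · filter_upwards [eventually_ge_atTop 0] with t ht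
      exact mul_le_of_le_one_right (hΓ.disc_pos ht).le (by linarith [S.FP.cdf_nonneg t])
  have h := (h1.add (tendsto_tsum_le_atTop hj)).add h3
  rw [add_zero] at h
  refine h.congr' ?_
  filter_upwards [eventually_ge_atTop 0] with t ht
  exact (ignoredA_eq hΓ ht).symm

lemma ignoredA_sub {s t : ℝ} (hs : 0 ≤ s) (ht : 0 ≤ t) :
    S.ignoredA Γ t - S.ignoredA Γ s = ∫ x in s..t, S.rateA Γ x := by
  rw [ignoredA, ignoredA, add_sub_add_left_eq_sub,
    intervalIntegral.integral_interval_sub_left (rateA_intervalIntegrable hΓ le_rfl ht)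
      (rateA_intervalIntegrable hΓ le_rfl hs)]

lemma ignoredA_continuousOn : ContinuousOn (S.ignoredA Γ) (Ici 0) := by
  have h : ∀ b : ℝ, 0 ≤ b → ContinuousOn (S.ignoredA Γ) (Icc 0 b) := fun b hb => by
    have := intervalIntegral.continuousOn_primitive_interval' (a := (0 : ℝ))
      (rateA_intervalIntegrable (S := S) hΓ le_rfl hb) (by simp)
    rw [uIcc_of_le hb] at this
    exact continuousOn_const.add this
  intro t ht
  have ht : (0 : ℝ) ≤ t := ht
  refine (h (t + 1) (by linarith) t ⟨ht, by linarith⟩).mono_of_mem_nhdsWithin ?_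
  exact inter_mem_nhdsWithin _ (Iic_mem_nhds (by linarith))

/-- Once the principal has surely stopped, waiting no longer affects the agent. -/
lemma ignoredA_eq_of_cdf_eq_one {s t : ℝ} (hs : 0 ≤ s) (hst : s ≤ t) (h : S.FP.cdf s = 1) :
    S.ignoredA Γ t = S.ignoredA Γ s := by
  have h1 := ignoredA_sub (S := S) hΓ hs (hs.trans hst)
  have h2 : ∫ x in s..t, S.rateA Γ x = 0 := by
    refine intervalIntegral.integral_zero_ae (ae_of_all _ fun x hx => ?_)
    rw [uIoc_of_le hst] at hx
    have : S.FP.cdf x = 1 := le_antisymm (S.FP.cdf_le_one x) (h ▸ S.FP.cdf_mono hx.1.le)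
    simp [rateA, this]
  linarith

lemma uA_eq_of_cdf_eq_one {s t : ℝ} (hs : 0 ≤ s) (hst : s ≤ t) (h : S.FP.cdf s = 1) :
    S.uA Γ t = S.ignoredA Γ s := by
  have : S.FP.cdf t = 1 := le_antisymm (S.FP.cdf_le_one t) (h ▸ S.FP.cdf_mono hst)
  rw [uA_eq hΓ (hs.trans hst), ignoredA_eq_of_cdf_eq_one hΓ hs hst h, this]
  ring

lemma uANever_eq_of_cdf_eq_one {s : ℝ} (hs : 0 ≤ s) (h : S.FP.cdf s = 1) :
    S.uANever Γ = S.ignoredA Γ s := by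
  refine tendsto_nhds_unique (tendsto_ignoredA hΓ) (tendsto_const_nhds.congr' ?_)
  filter_upwards [eventually_ge_atTop s] with t ht
  exact (ignoredA_eq_of_cdf_eq_one hΓ hs ht h).symm

/-- What the agent can gain by waiting is at most the probability that real news arrives before
the principal stops. -/
lemma ignoredA_sub_le {s t : ℝ} (hs : 0 ≤ s) (hst : s ≤ t) :
    S.ignoredA Γ t - S.ignoredA Γ s ≤ (1 - S.FP.cdf s) * (Γ.G t - Γ.G s) := by
  have ht := hs.trans hst
  rw [ignoredA_sub hΓ hs ht, hΓ.G_sub hs ht, ← intervalIntegral.integral_const_mul]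
  refine intervalIntegral.integral_mono_on hst (rateA_intervalIntegrable hΓ hs ht)
    ((hΓ.g_intervalIntegrable hs ht).const_mul _) fun x hx => ?_
  have hx0 := hs.trans hx.1
  have hg0 := hΓ.g_nonneg x hx0
  have hF0 : 0 ≤ 1 - S.FP.cdf x := sub_nonneg.2 (S.FP.cdf_le_one x)
  have hF1 : 1 - S.FP.cdf x ≤ 1 - S.FP.cdf s := sub_le_sub_left (S.FP.cdf_mono hx.1) 1
  have ha0 := S.a_nonneg x hx0
  have ha1 := S.a_le_one x hx0
  have hβ1 : Γ.β < 1 := hΓ.β_lt_μ.trans hΓ.μ_lt_one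
  have h1 : Γ.μ * (1 - Γ.β) * (S.a x * Γ.g x) ≤ Γ.g x := by
    have hc : Γ.μ * (1 - Γ.β) ≤ 1 := mul_le_one₀ hΓ.μ_lt_one.le
      (sub_pos.2 hβ1).le (by linarith [hΓ.β_pos])
    exact (mul_le_of_le_one_left (mul_nonneg ha0 hg0) hc).trans (mul_le_of_le_one_left hg0 ha1)
  have h2 : 0 ≤ Γ.ρ * Γ.β * (1 - Γ.G x) :=
    mul_nonneg (mul_nonneg hΓ.ρ_pos.le hΓ.β_pos.le) (hΓ.one_sub_G_pos hx0).le
  calc S.rateA Γ x ≤ Real.exp (-Γ.ρ * x) * ((1 - S.FP.cdf x) * Γ.g x) :=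
        mul_le_mul_of_nonneg_left (mul_le_mul_of_nonneg_left (by linarith) hF0)
          (Real.exp_pos _).le
    _ ≤ (1 - S.FP.cdf x) * Γ.g x :=
        mul_le_of_le_one_left (mul_nonneg hF0 hg0) (hΓ.exp_le_one hx0)
    _ ≤ (1 - S.FP.cdf s) * Γ.g x := mul_le_mul_of_nonneg_right hF1 hg0

lemma followedA_sub {s t : ℝ} (hs : 0 ≤ s) (hst : s ≤ t) (h : S.FP.cdf s = S.FP.cdf t) :
    IntervalIntegrable (fun x => Real.exp (-Γ.ρ * x) * ((1 - S.FP.cdf s) *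
      (Γ.μ * (1 - Γ.β) * (S.a x * Γ.g x) - (Γ.μ - Γ.β) * Γ.g x -
        Γ.ρ * Γ.μ * (1 - Γ.G x)))) volume s t ∧
    S.followedA Γ t - S.followedA Γ s = ∫ x in s..t, Real.exp (-Γ.ρ * x) * ((1 - S.FP.cdf s) *
      (Γ.μ * (1 - Γ.β) * (S.a x * Γ.g x) - (Γ.μ - Γ.β) * Γ.g x -
        Γ.ρ * Γ.μ * (1 - Γ.G x))) := by
  have ht := hs.trans hst
  have e : ∀ x ∈ uIoc s t,
      S.rateA Γ x + (1 - S.FP.cdf s) * (Γ.μ - Γ.β) * Γ.discDeriv x =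
      Real.exp (-Γ.ρ * x) * ((1 - S.FP.cdf s) *
      (Γ.μ * (1 - Γ.β) * (S.a x * Γ.g x) - (Γ.μ - Γ.β) * Γ.g x -
        Γ.ρ * Γ.μ * (1 - Γ.G x))) := by
    intro x hx
    rw [uIoc_of_le hst] at hx
    have hx' : S.FP.cdf x = S.FP.cdf s :=
      le_antisymm (h ▸ S.FP.cdf_mono hx.2) (S.FP.cdf_mono hx.1.le)
    rw [rateA, hx', Game.discDeriv]
    ring
  have i1 := rateA_intervalIntegrable (S := S) hΓ hs ht
  have i2 := (hΓ.discDeriv_intervalIntegrable hs ht).const_mul ((1 - S.FP.cdf s) * (Γ.μ - Γ.β))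
  refine ⟨(i1.add i2).congr e, ?_⟩
  rw [← intervalIntegral.integral_congr_ae (ae_of_all _ e), intervalIntegral.integral_add i1 i2,
    intervalIntegral.integral_const_mul, ← ignoredA_sub hΓ hs ht, ← hΓ.disc_sub hs hst,
    followedA, followedA, ← h]
  ring

/-- While the principal searches on and follows all news, the agent prefers to fake later. -/
lemma followedA_lt {τ : ℝ} (hτ : Γ.IsFirstBestDuration τ) {s t : ℝ} (hs : 0 ≤ s) (hst : s < t)
    (htτ : t ≤ τ) (h : S.FP.cdf s = S.FP.cdf t) (h1 : S.FP.cdf s < 1)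
    (ha : ∀ x ∈ Ioo s t, S.a x = 1) : S.followedA Γ s < S.followedA Γ t := by
  obtain ⟨hi, he⟩ := followedA_sub (S := S) hΓ hs hst.le h
  have : 0 < ∫ x in s..t, Real.exp (-Γ.ρ * x) * ((1 - S.FP.cdf s) *
      (Γ.μ * (1 - Γ.β) * (S.a x * Γ.g x) - (Γ.μ - Γ.β) * Γ.g x -
        Γ.ρ * Γ.μ * (1 - Γ.G x))) := by
    refine intervalIntegral.intervalIntegral_pos_of_pos_on hi (fun x hx => ?_) hst
    have := hΓ.wait_gain_pos hτ (hs.trans hx.1.le) (hx.2.le.trans htτ)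
    refine mul_pos (Real.exp_pos _) (mul_pos (sub_pos.2 h1) ?_)
    rw [ha x hx]
    linarith
  linarith

end Profile

end NewsSearch

/-! ### Equilibria with beneficial search -/

namespace NewsSearch

namespace Profile

variable {Γ : Game} {S : Profile} (hΓ : Γ.Standing) (hS : S.IsEquilibrium Γ)
  {τ : ℝ} (hτ : Γ.IsFirstBestDuration τ)
  {V : ℝ} (hV : S.FP.IsValue (S.uP Γ) (S.uPNever Γ) V) (hθV : Γ.θ < V)
  {U : ℝ} (hU : S.FA.IsValue (S.uA Γ) (S.uANever Γ) U)

section Principal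

include hΓ hS hτ hV

lemma FP_not_charges_of_gt {t : ℝ} (ht : τ < t) : ¬ S.FP.Charges t := fun hc =>
  ((hV.eq_of_charges t (hτ.1.trans ht.le) hc).symm.trans_lt
    ((uP_lt_of_firstBest_le hΓ hS hτ le_rfl ht).trans_le (hV.le τ hτ.1))).false

lemma FP_never : S.FP.never = 0 := by
  by_contra hne
  have hpos : 0 < S.FP.never := S.FP.never_nonneg.lt_of_ne (Ne.symm hne)
  have h1 : S.uPNever Γ ≤ S.uP Γ (τ + 1) := by
    refine le_of_tendsto (tendsto_uP hΓ hS) ?_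
    filter_upwards [eventually_gt_atTop (τ + 1)] with t ht
    exact (uP_lt_of_firstBest_le hΓ hS hτ (by linarith) ht).le
  have h2 := uP_lt_of_firstBest_le hΓ hS hτ le_rfl (lt_add_one τ)
  linarith [hV.le τ hτ.1, hV.eq_of_never hpos]

lemma FP_cdf_firstBest : S.FP.cdf τ = 1 := by
  rw [S.FP.cdf_eq_of_forall_gt fun _ hr => FP_not_charges_of_gt hΓ hS hτ hV hr,
    FP_never hΓ hS hτ hV, sub_zero]

include hθV in
omit hτ hV in
lemma pos_of_uP_eq {t : ℝ} (ht : 0 ≤ t) (h : S.uP Γ t = V) : 0 < t := by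
  refine ht.lt_of_ne fun e => ?_
  rw [← e, uP_zero hΓ hS] at h
  exact hθV.ne h

omit hτ in
/-- Just before a time that is optimal for the principal, type-1 news is sometimes followed. -/
lemma exists_a_eq_one {s t : ℝ} (hs : 0 ≤ s) (hst : s < t) (h : S.uP Γ t = V) :
    ∃ x ∈ Ioo s t, S.a x = 1 := by
  by_contra! hc
  have := uP_lt_of_a_ne_one hΓ hS hs hst hc
  linarith [hV.le s hs]

end Principal

include hΓ hS hτ hV hθV hU

/-- The principal may search right up to the first-best duration, and the agent fakes only before
it. If `T` is the earliest time by which the principal has surely stopped, then faking shortly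
before `T`, at a time when news is followed, beats faking at `T` or later: the probability that
real news still arrives before `T` is negligible. So there is no fake news from `T` on, and
searching on until the first-best duration would be profitable if that were later than `T`. -/
lemma faking_ends_before : S.FA.never = 0 ∧ (∀ t, τ ≤ t → ¬ S.FA.Charges t) ∧
    (∀ t < τ, S.FP.cdf t < 1) := by
  obtain ⟨T, hT0, hTτ, hT1, hTlt⟩ :=
    S.FP.exists_first_time one_pos (FP_cdf_firstBest hΓ hS hτ hV).ge
  have hFT : S.FP.cdf T = 1 := le_antisymm (S.FP.cdf_le_one T) hT1
  have hTV : S.uP Γ T = V := hV.eq_of_mem_support (uP_continuousOn hΓ hS) hT0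
    (S.FP.mem_support_of_lt fun s hs => hFT ▸ hTlt s hs)
  have hTpos := pos_of_uP_eq hΓ hS hθV hT0 hTV
  have hne : U ≠ S.ignoredA Γ T := by
    intro hUT
    have hcd := hΓ.disc_continuousOn.continuousAt (Ici_mem_nhds hTpos)
    have hcG := hΓ.G_continuousOn.continuousAt (Ici_mem_nhds hTpos)
    have hlim : Tendsto (fun s => Γ.disc s * (Γ.μ - Γ.β) - (Γ.G T - Γ.G s)) (𝓝[<] T)
        (𝓝 (Γ.disc T * (Γ.μ - Γ.β) - (Γ.G T - Γ.G T))) :=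
      ((hcd.tendsto.mul_const _).sub (hcG.tendsto.const_sub _)).mono_left nhdsWithin_le_nhds
    have hpos : 0 < Γ.disc T * (Γ.μ - Γ.β) - (Γ.G T - Γ.G T) := by
      rw [sub_self, sub_zero]
      exact mul_pos (hΓ.disc_pos hT0) (sub_pos.2 hΓ.β_lt_μ)
    obtain ⟨s₀, hs₀, hs⟩ := (mem_nhdsLT_iff_exists_Ioo_subset' hTpos).1
      ((hlim.eventually_const_lt hpos).and (Ioo_mem_nhdsLT hTpos))
    have hs₀' : max s₀ 0 < T := max_lt hs₀ hTpos
    obtain ⟨x, hx, hax⟩ := exists_a_eq_one hΓ hS hV (le_max_right s₀ 0) hs₀' hTV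
    have hx0 : 0 ≤ x := (le_max_right s₀ 0).trans hx.1.le
    have h1 := (hs ⟨(le_max_left s₀ 0).trans_lt hx.1, hx.2⟩).1
    have h2 := ignoredA_sub_le (S := S) hΓ hx0 hx.2.le
    have h3 := hU.le x hx0
    rw [uA_eq_followedA hΓ hx0 hax, followedA, hUT] at h3
    have h4 := mul_pos (sub_pos.2 (hTlt x hx.2)) h1
    linarith
  have hcharge : ∀ t, T ≤ t → ¬ S.FA.Charges t := fun t ht hc =>
    hne ((hU.eq_of_charges t (hT0.trans ht) hc).symm.trans
      (uA_eq_of_cdf_eq_one hΓ hT0 ht hFT))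
  have hTτ' : T = τ := by
    by_contra h
    have hlt : T < τ := lt_of_le_of_ne hTτ h
    have := uP_lt_of_ae_not_charges hΓ hS hτ hT0 hlt le_rfl
      (ae_of_all _ fun x hx => hcharge x hx.1.le)
    linarith [hV.le τ hτ.1]
  refine ⟨?_, hTτ' ▸ hcharge, hTτ' ▸ hTlt⟩
  by_contra hn
  exact hne ((hU.eq_of_never (S.FA.never_nonneg.lt_of_ne (Ne.symm hn))).symm.trans
    (uANever_eq_of_cdf_eq_one hΓ hT0 hFT))

lemma uP_firstBest : S.uP Γ τ = V := by
  have h := (faking_ends_before hΓ hS hτ hV hθV hU).2.2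
  refine hV.eq_of_mem_support (uP_continuousOn hΓ hS) hτ.1 (S.FP.mem_support_of_lt fun s hs => ?_)
  rw [FP_cdf_firstBest hΓ hS hτ hV]
  exact h s hs

omit hS hτ hV hθV hU in
lemma tendsto_followedA_right {t : ℝ} (ht : 0 ≤ t) :
    Tendsto (S.followedA Γ) (𝓝[>] t) (𝓝 (S.followedA Γ t)) := by
  have h1 : Tendsto (S.ignoredA Γ) (𝓝[>] t) (𝓝 (S.ignoredA Γ t)) :=
    ((ignoredA_continuousOn hΓ) t ht).mono_left (nhdsWithin_mono _ (Ioi_subset_Ici ht))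
  have h2 : Tendsto Γ.disc (𝓝[>] t) (𝓝 (Γ.disc t)) :=
    (hΓ.disc_continuousOn t ht).mono_left (nhdsWithin_mono _ (Ioi_subset_Ici ht))
  exact h1.add ((h2.mul ((S.FP.tendsto_cdf_right t).const_sub 1)).mul_const _)

omit hτ hV hθV in
/-- If fake news at `t` would pay more than the agent's value when followed, then it is not surely
followed, so the agent fakes at `t`, and `a t` makes faking worth exactly his value. -/
lemma followedA_sub_value {t : ℝ} (ht : 0 ≤ t) (h : U < S.followedA Γ t) :
    S.a t ≠ 1 ∧ S.followedA Γ t - U =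
      (1 - S.a t) * (Γ.disc t * (1 - S.FP.cdf t) * (Γ.μ - Γ.β)) := by
  have ha : S.a t ≠ 1 := fun ha => by
    have := hU.le t ht
    rw [uA_eq_followedA hΓ ht ha] at this
    linarith
  have hc : S.FA.Charges t := by
    by_contra hc
    exact ha (a_eq_one_of_not_charges hΓ hS ht hc)
  have h1 := hU.eq_of_charges t ht hc
  rw [uA_eq hΓ ht] at h1
  refine ⟨ha, ?_⟩
  rw [followedA, ← h1]
  ring

/-- Before the first-best duration, fake news never pays more than the agent's value, even when
it is followed. Otherwise let `[t, t₁)` be a maximal interval on which it does. There news is not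
surely followed, so the principal's payoff decreases and she does not stop; hence `t₁ < τ`. Towards
`t₁` the probability of following news tends to `1`, so `followedA` increases there, and cannot
have dropped to the agent's value at `t₁`. -/
lemma followedA_le {t : ℝ} (ht : 0 ≤ t) (htτ : t < τ) : S.followedA Γ t ≤ U := by
  by_contra! ht₀
  let A := {s | t ≤ s ∧ (τ ≤ s ∨ S.followedA Γ s ≤ U)}
  have hτA : τ ∈ A := ⟨htτ.le, Or.inl le_rfl⟩
  have hbdd : BddBelow A := ⟨t, fun s hs => hs.1⟩
  obtain ⟨t₁, ht₁⟩ : ∃ t₁, t₁ = sInf A := ⟨_, rfl⟩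
  have htt₁ : t ≤ t₁ := ht₁ ▸ le_csInf ⟨τ, hτA⟩ fun s hs => hs.1
  have ht₁τ : t₁ ≤ τ := ht₁ ▸ csInf_le hbdd hτA
  have ht₁0 : 0 ≤ t₁ := ht.trans htt₁
  have hlt : ∀ s, t ≤ s → s < t₁ → U < S.followedA Γ s := fun s hs hs1 => by
    by_contra! h
    exact (csInf_le hbdd (⟨hs, Or.inr h⟩ : s ∈ A)).not_gt (ht₁ ▸ hs1)
  have hle : t₁ < τ → S.followedA Γ t₁ ≤ U := fun h => by
    by_contra! hgt
    obtain ⟨u, hu, hsub⟩ := (mem_nhdsGT_iff_exists_Ioo_subset' h).1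
      (((tendsto_followedA_right hΓ ht₁0).eventually_const_lt hgt).and (Ioo_mem_nhdsGT h))
    have : u ≤ sInf A := by
      refine le_csInf ⟨τ, hτA⟩ fun s hs => ?_
      by_contra! hsu
      have hs1 : t₁ ≤ s := ht₁ ▸ csInf_le hbdd hs
      have hU' : U < S.followedA Γ s ∧ s < τ := by
        rcases hs1.eq_or_lt with e | e
        · exact e ▸ ⟨hgt, h⟩
        · exact ⟨(hsub ⟨e, hsu⟩).1, (hsub ⟨e, hsu⟩).2.2⟩
      rcases hs.2 with h' | h'
      exacts [hU'.2.not_ge h', hU'.1.not_ge h']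
    exact (ht₁ ▸ this).not_gt hu
  have htlt : t < t₁ := by
    refine htt₁.lt_of_ne fun e => ?_
    exact (e ▸ hle (e ▸ htτ) : S.followedA Γ t ≤ U).not_gt ht₀
  have hdecr : ∀ x, t < x → x ≤ t₁ → S.uP Γ x < S.uP Γ t := fun x hx hx1 =>
    uP_lt_of_a_ne_one hΓ hS ht hx fun y hy =>
      (followedA_sub_value hΓ hS hU (ht.trans hy.1.le)
        (hlt y hy.1.le (hy.2.trans_le hx1))).1
  have ht₁lt : t₁ < τ := by
    refine ht₁τ.lt_of_ne fun e => ?_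
    have h1 := hdecr t₁ htlt le_rfl
    rw [e, uP_firstBest hΓ hS hτ hV hθV hU] at h1
    exact (hV.le t ht).not_gt h1
  have hF : ∀ x, t ≤ x → x ≤ t₁ → S.FP.cdf x = S.FP.cdf t := fun x hx hx1 =>
    (S.FP.cdf_eq_of_not_charges hx fun r hr hc =>
      ((hV.eq_of_charges r (ht.trans hr.1.le) hc).symm.trans_lt
        ((hdecr r hr.1 (hr.2.trans hx1)).trans_le (hV.le t ht))).false).symm
  have hF1 : 0 < 1 - S.FP.cdf t :=
    sub_pos.2 ((faking_ends_before hΓ hS hτ hV hθV hU).2.2 t htτ)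
  have hμβ : 0 < Γ.μ - Γ.β := sub_pos.2 hΓ.β_lt_μ
  have ht₁pos : 0 < t₁ := ht.trans_lt htlt
  -- Near `t₁` the probability `1 - a` of ignoring news is small compared to the gain from waiting.
  have hlimF : Tendsto (S.followedA Γ) (𝓝[<] t₁) (𝓝 (S.followedA Γ t₁)) := by
    have h1 := ((ignoredA_continuousOn (S := S) hΓ).continuousAt
      (Ici_mem_nhds ht₁pos)).tendsto
    have h2 := (hΓ.disc_continuousOn.continuousAt (Ici_mem_nhds ht₁pos)).tendsto
    have h3 := (h1.add ((h2.mul_const (1 - S.FP.cdf t)).mul_const (Γ.μ - Γ.β))).mono_left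
      (nhdsWithin_le_nhds (s := Iio t₁))
    rw [followedA, hF t₁ htt₁ le_rfl]
    refine h3.congr' ?_
    filter_upwards [Ioo_mem_nhdsLT htlt] with x hx
    rw [followedA, hF x hx.1.le hx.2.le]
  have hc0 : 0 < Γ.β * (1 - Γ.μ) * (Γ.φP - Γ.φA) :=
    mul_pos (mul_pos hΓ.β_pos (sub_pos.2 hΓ.μ_lt_one)) (sub_pos.2 hΓ.φA_lt_φP)
  have hK0 : 0 ≤ Γ.μ * (1 - Γ.β) * Γ.hazard 0 :=
    mul_nonneg (mul_nonneg hΓ.μ_pos.le (by linarith [hΓ.β_lt_μ, hΓ.μ_lt_one]))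
      (div_nonneg (hΓ.g_nonneg 0 le_rfl) (hΓ.one_sub_G_pos le_rfl).le)
  have hdisc := (hΓ.disc_continuousOn.continuousAt (Ici_mem_nhds ht₁pos)).tendsto.mono_left
    (nhdsWithin_le_nhds (s := Iio t₁))
  have hev : ∀ᶠ x in 𝓝[<] t₁, (S.followedA Γ x - U) * (Γ.μ * (1 - Γ.β) * Γ.hazard 0) <
      Γ.β * (1 - Γ.μ) * (Γ.φP - Γ.φA) * (Γ.disc x * (1 - S.FP.cdf t) * (Γ.μ - Γ.β)) := by
    refine ((hlimF.sub_const U).mul_const _).eventually_lt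
      (((hdisc.mul_const _).mul_const _).const_mul _) ?_
    refine (mul_nonpos_of_nonpos_of_nonneg (sub_nonpos.2 (hle ht₁lt)) hK0).trans_lt ?_
    exact mul_pos hc0 (mul_pos (mul_pos (hΓ.disc_pos ht₁0) hF1) hμβ)
  obtain ⟨s₀, hs₀, hsub⟩ := (mem_nhdsLT_iff_exists_Ioo_subset' htlt).1 hev
  obtain ⟨s, hs1, hs2⟩ := exists_between (max_lt hs₀ htlt)
  have hts : t < s := (le_max_right _ _).trans_lt hs1
  have hs0 : 0 ≤ s := ht.trans hts.le
  have hFs := hF s hts.le hs2.le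
  obtain ⟨hi, he⟩ := followedA_sub (S := S) hΓ hs0 hs2.le (hFs.trans (hF t₁ htt₁ le_rfl).symm)
  have hint : 0 < ∫ x in s..t₁, Real.exp (-Γ.ρ * x) * ((1 - S.FP.cdf s) *
      (Γ.μ * (1 - Γ.β) * (S.a x * Γ.g x) - (Γ.μ - Γ.β) * Γ.g x -
        Γ.ρ * Γ.μ * (1 - Γ.G x))) := by
    refine intervalIntegral.intervalIntegral_pos_of_pos_on hi (fun x hx => ?_) hs2
    have hx0 : 0 ≤ x := hs0.trans hx.1.le
    have htx : t < x := hts.trans hx.1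
    refine mul_pos (Real.exp_pos _) (mul_pos (hFs.symm ▸ hF1) ?_)
    have h1 := hsub ⟨((le_max_left _ _).trans_lt hs1).trans hx.1, hx.2⟩
    have h1 : (S.followedA Γ x - U) * (Γ.μ * (1 - Γ.β) * Γ.hazard 0) <
      Γ.β * (1 - Γ.μ) * (Γ.φP - Γ.φA) * (Γ.disc x * (1 - S.FP.cdf t) * (Γ.μ - Γ.β)) := h1
    have h2 := (followedA_sub_value hΓ hS hU hx0 (hlt x htx.le hx.2)).2
    rw [hF x htx.le hx.2.le] at h2
    have hm : 0 < Γ.disc x * (1 - S.FP.cdf t) * (Γ.μ - Γ.β) :=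
      mul_pos (mul_pos (hΓ.disc_pos hx0) hF1) hμβ
    have h3 : (1 - S.a x) * (Γ.μ * (1 - Γ.β) * Γ.hazard 0) <
        Γ.β * (1 - Γ.μ) * (Γ.φP - Γ.φA) := by
      rw [h2] at h1
      refine lt_of_mul_lt_mul_right ?_ hm.le
      linarith
    have hG := hΓ.one_sub_G_pos hx0
    have h4 := hΓ.wait_gain_ge hτ hx0 (hx.2.le.trans ht₁τ)
    have h5 : Γ.g x ≤ Γ.hazard 0 * (1 - Γ.G x) := by
      rw [← div_le_iff₀ hG]
      exact hΓ.hazard_anti.antitoneOn (mem_Ici.2 le_rfl) hx0 hx0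
    have h6 : 0 ≤ (1 - S.a x) * (Γ.μ * (1 - Γ.β)) :=
      mul_nonneg (sub_nonneg.2 (S.a_le_one x hx0))
        (mul_nonneg hΓ.μ_pos.le (by linarith [hΓ.β_lt_μ, hΓ.μ_lt_one]))
    have h7 := mul_le_mul_of_nonneg_left h5 h6
    have h8 := mul_lt_mul_of_pos_right h3 hG
    linarith
  linarith [hle ht₁lt, hlt s hts.le hs2]

/-- All type-1 news is followed. -/
lemma a_eq_one {t : ℝ} (ht : 0 ≤ t) : S.a t = 1 := by
  obtain ⟨-, hc, hF⟩ := faking_ends_before hΓ hS hτ hV hθV hU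
  by_contra ha
  have hch : S.FA.Charges t := by
    by_contra h
    exact ha (a_eq_one_of_not_charges hΓ hS ht h)
  have htτ : t < τ := by
    by_contra! h
    exact hc t h hch
  have h1 := hU.eq_of_charges t ht hch
  have h2 := followedA_le hΓ hS hτ hV hθV hU ht htτ
  have h3 : 0 < (1 - S.a t) * (Γ.disc t * (1 - S.FP.cdf t) * (Γ.μ - Γ.β)) :=
    mul_pos (sub_pos.2 (lt_of_le_of_ne (S.a_le_one t ht) ha))
      (mul_pos (mul_pos (hΓ.disc_pos ht) (sub_pos.2 (hF t htτ))) (sub_pos.2 hΓ.β_lt_μ))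
  rw [uA_eq hΓ ht] at h1
  rw [followedA] at h2
  linarith

lemma uA_eq_followed {t : ℝ} (ht : 0 ≤ t) : S.uA Γ t = S.followedA Γ t :=
  uA_eq_followedA hΓ ht (a_eq_one hΓ hS hτ hV hθV hU ht)

lemma FA_atom (t : ℝ) : S.FA.atom t = 0 := by
  rcases lt_or_ge t 0 with ht | ht
  · exact S.FA.atom_neg t ht
  · rcases (S.FA.atom_nonneg t).eq_or_lt with h | h
    · exact h.symm
    · have h1 := a_eq_zero_of_atom hΓ hS ht h
      rw [a_eq_one hΓ hS hτ hV hθV hU ht] at h1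
      exact absurd h1 one_ne_zero

/-- An atom of the stopping strategy before the first-best duration would make the agent's payoff
from faking drop below his value right after it; in the absence of fake news the principal would
then rather search on. -/
lemma FP_atom {t : ℝ} (htτ : t ≠ τ) : S.FP.atom t = 0 := by
  rcases lt_or_ge t 0 with ht | ht
  · exact S.FP.atom_neg t ht
  rcases htτ.lt_or_gt with htτ | htτ
  swap
  · exact (TimeStrategy.not_charges_iff.1 (FP_not_charges_of_gt hΓ hS hτ hV htτ)).2
  rcases (S.FP.atom_nonneg t).eq_or_lt with h | h
  · exact h.symm
  exfalso
  have htV := hV.eq_of_charges t ht (Or.inr h)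
  have htpos := pos_of_uP_eq hΓ hS hθV ht htV
  have hμβ : 0 < Γ.μ - Γ.β := sub_pos.2 hΓ.β_lt_μ
  have h1 := ((ignoredA_continuousOn (S := S) hΓ).continuousAt (Ici_mem_nhds htpos)).tendsto
  have h2 := (hΓ.disc_continuousOn.continuousAt (Ici_mem_nhds htpos)).tendsto
  have h3 := (h1.add ((h2.mul_const (1 - S.FP.cdf t + S.FP.atom t)).mul_const
    (Γ.μ - Γ.β))).mono_left (nhdsWithin_le_nhds (s := Iio t))
  have h4 : S.ignoredA Γ t + Γ.disc t * (1 - S.FP.cdf t + S.FP.atom t) * (Γ.μ - Γ.β) ≤ U := by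
    refine le_of_tendsto h3 ?_
    filter_upwards [Ioo_mem_nhdsLT htpos] with x hx
    have h5 := followedA_le hΓ hS hτ hV hθV hU hx.1.le (hx.2.trans htτ)
    have h6 := S.FP.cdf_add_atom_le hx.2
    refine le_trans (add_le_add_right (mul_le_mul_of_nonneg_right
      (mul_le_mul_of_nonneg_left ?_ (hΓ.disc_pos hx.1.le).le) hμβ.le) _) h5
    linarith
  have h5 : S.followedA Γ t < U := by
    have := mul_pos (mul_pos (hΓ.disc_pos ht) h) hμβ
    rw [followedA]
    linarith
  obtain ⟨u, hu, hsub⟩ := (mem_nhdsGT_iff_exists_Ioo_subset' htτ).1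
    ((tendsto_followedA_right hΓ ht).eventually_lt_const h5)
  obtain ⟨y, hy1, hy2⟩ := exists_between (lt_min hu htτ)
  have hyu : y < u := hy2.trans_le (min_le_left _ _)
  have hyτ : y < τ := hy2.trans_le (min_le_right _ _)
  have h6 := uP_lt_of_ae_not_charges hΓ hS hτ ht hy1 hyτ.le (ae_of_all _ fun x hx hc => by
    have hx0 : 0 ≤ x := ht.trans hx.1.le
    have h7 := hU.eq_of_charges x hx0 hc
    rw [uA_eq_followed hΓ hS hτ hV hθV hU hx0] at h7
    have h8 : S.followedA Γ x < U := hsub ⟨hx.1, hx.2.trans_lt hyu⟩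
    exact h8.ne h7)
  linarith [hV.le y (ht.trans hy1.le)]

/-- The agent does not fake during an interval in which the principal surely does not stop. -/
lemma FA_not_charges_of_gap {s t : ℝ} (hs : 0 ≤ s) (htτ : t ≤ τ)
    (h : S.FP.cdf s = S.FP.cdf t) (h1 : S.FP.cdf s < 1) {x : ℝ} (hx : x ∈ Ico s t) :
    ¬ S.FA.Charges x := by
  intro hc
  have hx0 : 0 ≤ x := hs.trans hx.1
  have ht0 : 0 ≤ t := hx0.trans hx.2.le
  have hFx : S.FP.cdf x = S.FP.cdf s :=
    le_antisymm (h ▸ S.FP.cdf_mono hx.2.le) (S.FP.cdf_mono hx.1)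
  have h2 := followedA_lt (S := S) hΓ hτ hx0 hx.2 htτ (hFx.trans h) (hFx ▸ h1)
    fun y hy => a_eq_one hΓ hS hτ hV hθV hU (hx0.trans hy.1.le)
  rw [← uA_eq_followed hΓ hS hτ hV hθV hU hx0, ← uA_eq_followed hΓ hS hτ hV hθV hU ht0,
    hU.eq_of_charges x hx0 hc] at h2
  exact (hU.le t ht0).not_gt h2

/-- From any time in the support of the stopping strategy, the principal stops with positive
probability in every interval up to the first-best duration. -/
lemma FP_cdf_lt_of_mem_support {s t : ℝ} (hs : 0 ≤ s) (hsupp : s ∈ S.FP.support) (hst : s < t)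
    (htτ : t ≤ τ) : S.FP.cdf s < S.FP.cdf t := by
  by_contra! h
  have he : S.FP.cdf s = S.FP.cdf t := le_antisymm (S.FP.cdf_mono hst.le) h
  have hF1 := (faking_ends_before hΓ hS hτ hV hθV hU).2.2 s (hst.trans_le htτ)
  obtain ⟨y, hsy, hyt⟩ := exists_between hst
  have h1 := uP_lt_of_ae_not_charges hΓ hS hτ hs hsy (hyt.le.trans htτ)
    (ae_of_all _ fun x hx => FA_not_charges_of_gap hΓ hS hτ hV hθV hU hs htτ he hF1
      ⟨hx.1.le, hx.2.trans_lt hyt⟩)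
  rw [hV.eq_of_mem_support (uP_continuousOn hΓ hS) hs hsupp] at h1
  exact (hV.le y (hs.trans hsy.le)).not_gt h1

/-- The common support of the two strategies. -/
lemma exists_common_support : ∃ τM, 0 < τM ∧ τM < τ ∧
    S.FA.support = Icc τM τ ∧ S.FP.support = Icc τM τ := by
  obtain ⟨hnever, hFAτ, hF1⟩ := faking_ends_before hΓ hS hτ hV hθV hU
  have hFPτ := FP_cdf_firstBest hΓ hS hτ hV
  let A := {t | 0 < S.FP.cdf t}
  have hA0 : ∀ t ∈ A, 0 ≤ t := fun t ht => by
    by_contra! h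
    have ht' : 0 < S.FP.cdf t := ht
    exact ht'.ne' (S.FP.cdf_of_neg h)
  have hbdd : BddBelow A := ⟨0, hA0⟩
  have hτA : τ ∈ A := by
    have : 0 < S.FP.cdf τ := hFPτ ▸ one_pos
    exact this
  obtain ⟨m, hm⟩ : ∃ m, m = sInf A := ⟨_, rfl⟩
  have hm0 : 0 ≤ m := hm ▸ le_csInf ⟨τ, hτA⟩ hA0
  have hmτ : m ≤ τ := hm ▸ csInf_le hbdd hτA
  have hzero : ∀ t < m, S.FP.cdf t = 0 := fun t ht => by
    by_contra h
    have hpos : t ∈ A := (S.FP.cdf_nonneg t).lt_of_ne (Ne.symm h)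
    exact (csInf_le hbdd hpos).not_gt (hm ▸ ht)
  have hpos : ∀ t, m < t → 0 < S.FP.cdf t := fun t ht => by
    obtain ⟨s, hs, hst⟩ := exists_lt_of_csInf_lt ⟨τ, hτA⟩ (hm ▸ ht)
    have hs' : 0 < S.FP.cdf s := hs
    exact hs'.trans_le (S.FP.cdf_mono hst.le)
  have hmsupp : m ∈ S.FP.support := fun ε hε => by
    rw [hzero (m - ε) (by linarith)]
    exact hpos _ (by linarith)
  have hmpos : 0 < m := pos_of_uP_eq hΓ hS hθV hm0
    (hV.eq_of_mem_support (uP_continuousOn hΓ hS) hm0 hmsupp)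
  have hFAm : ∀ t < m, ¬ S.FA.Charges t := fun t ht => by
    rcases lt_or_ge t 0 with h0 | h0
    · exact S.FA.not_charges_of_neg h0
    · obtain ⟨y, hty, hym⟩ := exists_between ht
      exact FA_not_charges_of_gap hΓ hS hτ hV hθV hU h0 (hym.le.trans hmτ)
        ((hzero t ht).trans (hzero y hym).symm) (hzero t ht ▸ one_pos) ⟨le_rfl, hty⟩
  have hmlt : m < τ := by
    refine hmτ.lt_of_ne fun e => ?_
    rcases S.FA.never_pos_or_exists_charges with h | ⟨t, -, h⟩
    · exact h.ne' hnever
    · rcases lt_or_ge t m with ht | ht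
      exacts [hFAm t ht h, hFAτ t (e ▸ ht) h]
  have hFPmono : StrictMonoOn S.FP.cdf (Icc m τ) := by
    intro x hx y hy hxy
    by_contra! hle
    have he : S.FP.cdf x = S.FP.cdf y := le_antisymm (S.FP.cdf_mono hxy.le) hle
    -- The first time at which the common value is reached lies in the support.
    obtain ⟨z, hz0, hzx, hzc, hz⟩ :=
      S.FP.exists_first_time (he ▸ hpos y (hx.1.trans_lt hxy)) (le_refl (S.FP.cdf x))
    have hzsupp : z ∈ S.FP.support := S.FP.mem_support_of_lt fun s hs => (hz s hs).trans_le hzc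
    have := FP_cdf_lt_of_mem_support hΓ hS hτ hV hθV hU hz0 hzsupp (hzx.trans_lt hxy) hy.2
    linarith
  have hFPsupp := S.FP.support_eq_Icc hmlt hzero hFPτ hFPmono
  have hFAmono : StrictMonoOn S.FA.cdf (Icc m τ) := by
    intro x hx y hy hxy
    by_contra! hle
    have he : S.FA.cdf x = S.FA.cdf y := le_antisymm (S.FA.cdf_mono hxy.le) hle
    have hx0 : 0 ≤ x := hm0.trans hx.1
    have h1 := uP_lt_of_ae_not_charges hΓ hS hτ hx0 hxy hy.2 (by
      filter_upwards [S.FA.ae_density_eq_zero hxy.le he] with r hr hrm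
      exact TimeStrategy.not_charges_iff.2 ⟨hr hrm, FA_atom hΓ hS hτ hV hθV hU r⟩)
    rw [hV.eq_of_mem_support (uP_continuousOn hΓ hS) hx0 (hFPsupp ▸ hx)] at h1
    exact (hV.le y (hx0.trans hxy.le)).not_gt h1
  have hFA1 : S.FA.cdf τ = 1 := by
    rw [S.FA.cdf_eq_of_forall_gt fun r hr => hFAτ r hr.le, hnever, sub_zero]
  exact ⟨m, hmpos, hmlt, S.FA.support_eq_Icc hmlt
    (fun t ht => S.FA.cdf_eq_zero_of_not_charges fun r hr => hFAm r (hr.trans_lt ht))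
    hFA1 hFAmono, hFPsupp⟩

end Profile

end NewsSearch

end

theorem proposition1 (Γ : NewsSearch.Game) (hΓ : Γ.Standing)
    (τP : ℝ) (hτP : Γ.IsFirstBestDuration τP)
    (S : NewsSearch.Profile) (hS : S.IsEquilibrium Γ) (hben : S.BeneficialSearch Γ) :
    ∃ τM : ℝ, 0 < τM ∧ τM < τP ∧
      ((∀ t, S.FA.atom t = 0) ∧ S.FA.never = 0 ∧ S.FA.support = Set.Icc τM τP) ∧
      ((∀ t, t ≠ τP → S.FP.atom t = 0) ∧ S.FP.never = 0 ∧ S.FP.support = Set.Icc τM τP) ∧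
      (∀ t, 0 ≤ t → S.a t = 1) := by
  obtain ⟨V, hV⟩ := hS.principal.exists_isValue
  obtain ⟨U, hU⟩ := hS.agent.exists_isValue
  have hθV : Γ.θ < V := hV.expect_eq ▸ hben
  obtain ⟨τM, h0, hlt, hA, hP⟩ :=
    NewsSearch.Profile.exists_common_support hΓ hS hτP hV hθV hU
  exact ⟨τM, h0, hlt,
    ⟨NewsSearch.Profile.FA_atom hΓ hS hτP hV hθV hU,
      (NewsSearch.Profile.faking_ends_before hΓ hS hτP hV hθV hU).1, hA⟩,
    ⟨fun t ht => NewsSearch.Profile.FP_atom hΓ hS hτP hV hθV hU ht,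
      NewsSearch.Profile.FP_never hΓ hS hτP hV, hP⟩,
    fun t ht => NewsSearch.Profile.a_eq_one hΓ hS hτP hV hθV hU ht⟩
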